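/- Let $\mathcal P$ be a finite $(d-1)$-dimensional cubical complex, $d\ge 1$, with a shelling $F_1,\dots,F_r$: the $F_t$ are the facets of $\mathcal P$, all of them $(d-1)$-cubes, and for $t>1$ the intersection $F_t\cap(F_1\cup\dots\cup F_{t-1})$ is a union of $(d-2)$-faces of $F_t$, of which $i$ are antipodally unpaired while the others form $j$ antipodal pairs, where $i\ge 1$ or $j=d-1$. The component $F_t$ then has type $(i,j)$; the first component $F_1$ has type $(0,0)$. For a finite lower Eulerian poset $P$ with minimum $\hat 0$, rank function $\rho$ and maximal rank $d$, let $$f(P,x)=\sum_{t\in P} g([\hat 0,t),x)\,(x-1)^{d-\rho(t)},$$ where $g([\hat 0,\hat 0),x)=1$ and, for $t$ of rank $e+1\ge 1$ with $f([\hat 0,t),x)=\sum_{s<t}g([\hat 0,s),x)(x-1)^{e-\rho(s)}=k_0+k_1x+\cdots$, $g([\hat 0,t),x)=\sum_{l=0}^{\lfloor e/2\rfloor}(k_l-k_{l-1})x^l$ with $k_{-1}=0$. Let $C_n=\frac1{n+1}\binom{2n}{n}$ and, for $j<d-1$, $$f_d(i,j,x)=\sum_{k=0}^{d-1} C_{d-1-k}(1-x)^k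 x^{d-k}\sum_{s=0}^{j}\binom{j}{s}\binom{d+i+j-1-k-s}{k-s},$$ where $\binom{n}{l}=0$ for $l<0$. Let $(i,j)$ be the type of a shelling component $F_t$ as above, and assume $j<d-1$. Then $f_d(i,j,x)$ is the change of the toric polynomial $f(\cdot,x)$ of the face poset (with the empty face included) when $F_t$ is added to $F_1\cup\dots\cup F_{t-1}$ (for $t=1$: the whole polynomial $f$ of the face poset of $F_1$), and for every $0\le m\le d$ the coefficient of $x^{d-m}$ in $f_d(i,j,x)$ is the number of noncrossing partitions of $\{1,2,\dots,d-1\}$ with exactly $m$ elements $v$ having one of the following (mutually exclusive) properties: (a) $v$ is the minimum of a nonsingleton block; (b) $\{v\}$ is a singleton block, and $v\le i$ or $v\ge d-j$; (c) $v\ge d-j$, $v$ is not the minimum of its block, and if $v$ is the maximum of its block then the block contains $1$. Here a partition is noncrossing if, whenever $a<b<c<e$ with $a,c$ in one block and $b,e$ in one block, all four lie in the same block. -/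

import Mathlib

open Polynomial

/-! ### The toric polynomials `f` and `g` -/

/-- The rank of an element of a finite poset with minimum: the length of a longest chain from the
minimum to it. -/
noncomputable def posetRank {P : Type*} [PartialOrder P] (a : P) : ℕ :=
  (Order.height a).toNat

/-- For `f = k₀ + k₁ x + ⋯`, the polynomial `∑_{i = 0}^{⌊d/2⌋} (kᵢ - kᵢ₋₁) xⁱ`, with `k₋₁ = 0`. -/
noncomputable def truncatedDiff (d : ℕ) (f : ℤ[X]) : ℤ[X] :=
  ∑ i ∈ Finset.range (d / 2 + 1),
    C (f.coeff i - if i = 0 then 0 else f.coeff (i - 1)) * X ^ i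

open Classical in
/-- The toric polynomial `g([0, t), x)` of the half-open interval below `t`, in a finite lower
Eulerian poset. It is `1` for `t = 0`; for `t` of rank `d + 1 ≥ 1` it is the truncated difference
of `f([0, t), x) = ∑_{s < t} g([0, s), x) (x - 1) ^ (d - ρ(s))`. -/
noncomputable def toricG {P : Type*} [Fintype P] [PartialOrder P] [OrderBot P] : P → ℤ[X] :=
  (wellFounded_lt (α := P)).fix fun t g =>
    if t = ⊥ then 1
    else truncatedDiff (posetRank t - 1)
      (∑ s : {s : P // s < t}, g s.1 s.2 * (X - 1) ^ (posetRank t - 1 - posetRank s.1))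

open Classical in
/-- The recursion that defines `toricG`. -/
theorem toricG_eq {P : Type*} [Fintype P] [PartialOrder P] [OrderBot P] (t : P) :
    toricG t = if t = ⊥ then 1
      else truncatedDiff (posetRank t - 1)
        (∑ s : {s : P // s < t},
          toricG s.1 * (X - 1) ^ (posetRank t - 1 - posetRank s.1)) := by
  unfold toricG
  rw [WellFounded.fix_eq]

open Classical in
/-- The toric polynomial `f(K, x) = ∑_{t ∈ K} g([0, t), x) (x - 1) ^ (d - ρ(t))` of a lower set `K`
of a finite lower Eulerian poset, regarded as a poset of its own; `d` is the largest rank in `K`.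
(The interval `[0, t)` and the rank of `t` are the same in `K` as in the whole poset.)
For `K` without any element the sum is empty and has the value `0`. -/
noncomputable def toricF {P : Type*} [Fintype P] [PartialOrder P] [OrderBot P] (K : Set P) :
    ℤ[X] :=
  ∑ t ∈ Finset.univ.filter (fun t => t ∈ K),
    toricG t *
      (X - 1) ^ ((Finset.univ.filter (fun s => s ∈ K)).sup posetRank - posetRank t)

/-! ### Cubes and cubical complexes -/

/-- A nonempty face of the cube `[0,1]ⁿ`: each coordinate is fixed at one of its two end values
(`some false`, `some true`) or is free (`none`). -/
def CubeFace (n : ℕ) : Type := Fin n → Option Bool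

/-- Inclusion of faces of the cube. -/
instance (n : ℕ) : PartialOrder (CubeFace n) where
  le a b := ∀ k, b k = none ∨ a k = b k
  le_refl a k := Or.inr rfl
  le_trans a b c hab hbc k := by
    rcases hbc k with h | h
    · exact Or.inl h
    · rcases hab k with h' | h'
      · exact Or.inl (h ▸ h')
      · exact Or.inr (h'.trans h)
  le_antisymm a b hab hba := by
    funext k
    rcases hab k with h | h
    · rcases hba k with h' | h'
      · rw [h, h']
      · exact h'.symm
    · exact h

/-- The facet of the `n`-cube on which coordinate `p.1` is fixed at the end value `p.2`. The facets
for `(k, false)` and `(k, true)` are antipodal. -/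
def cubeFacet {n : ℕ} (p : Fin n × Bool) : CubeFace n :=
  fun k => if k = p.1 then some p.2 else none

/-- `P` is the face poset (with the empty face `⊥`) of a finite cubical complex: any two faces
meet in a face (this is the assumption `SemilatticeInf P`), and the faces of each nonempty face
form the face lattice of a cube. -/
def IsCubicalComplex (P : Type*) [SemilatticeInf P] [OrderBot P] : Prop :=
  ∀ a : P, a ≠ ⊥ → ∃ n : ℕ, Nonempty (Set.Iic a ≃o WithBot (CubeFace n))

/-- The number of facets in `S`, a set of facets of the `n`-cube, whose antipodal facet is not in
`S`. -/
def antipodallyUnpaired {n : ℕ} (S : Finset (Fin n × Bool)) : ℕ :=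
  (S.filter fun p => (p.1, !p.2) ∉ S).card

/-- The number of pairs of antipodal facets of the `n`-cube that lie in `S`. -/
def antipodalPairs {n : ℕ} (S : Finset (Fin n × Bool)) : ℕ :=
  (Finset.univ.filter fun k : Fin n => (k, false) ∈ S ∧ (k, true) ∈ S).card

/-- The `t`-th facet `F t`, a `(d-1)`-cube, has type `(i, j)` in the list of facets `F`: its
intersection with the union of the earlier facets is the union of a set `S` of `(d-2)`-faces of
`F t`, of which `i` are antipodally unpaired, the others forming `j` antipodal pairs. -/
def HasComponentType {P : Type*} [PartialOrder P] {r : ℕ} (d : ℕ) (F : Fin r → P) (t : Fin r)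
    (i j : ℕ) : Prop :=
  ∃ (e : Set.Iic (F t) ≃o WithBot (CubeFace (d - 1))) (S : Finset (Fin (d - 1) × Bool)),
    (∀ a : Set.Iic (F t), e a ≠ ⊥ →
      ((∃ u < t, a.1 ≤ F u) ↔ ∃ p ∈ S, e a ≤ (cubeFacet p : CubeFace (d - 1)))) ∧
    antipodallyUnpaired S = i ∧ antipodalPairs S = j

/-- The list `F` is a shelling of the `(d-1)`-dimensional cubical complex with face poset `P`, and
`τ t` is the type of its `t`-th shelling component: `F` lists the facets of the complex without
repetition, each is a `(d-1)`-cube of type `τ t`, and for each facet `F t` but the first one the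
type `(i, j)` satisfies `i ≥ 1` or `j = d - 1`. -/
structure IsCubicalShelling {P : Type*} [PartialOrder P] {r : ℕ} (d : ℕ) (F : Fin r → P)
    (τ : Fin r → ℕ × ℕ) : Prop where
  dim_pos : 1 ≤ d
  injective : Function.Injective F
  facets : ∀ a : P, (∃ t, F t = a) ↔ IsMax a
  type : ∀ t, HasComponentType d F t (τ t).1 (τ t).2
  ball_or_sphere : ∀ t : Fin r, 0 < t.1 → 1 ≤ (τ t).1 ∨ (τ t).2 = d - 1

/-- The change of the toric polynomial `f` when the facet `F t` is added to the earlier ones. -/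
noncomputable def shellingContribution {P : Type*} [Fintype P] [PartialOrder P] [OrderBot P]
    {r : ℕ} (F : Fin r → P) (t : Fin r) : ℤ[X] :=
  toricF {a | ∃ u ≤ t, a ≤ F u} - toricF {a | ∃ u < t, a ≤ F u}

/-- The polynomial `f_d(i, j, x)`. -/
noncomputable def fPoly (d i j : ℕ) : ℤ[X] :=
  if j = d - 1 then
    ∑ k ∈ Finset.range d,
      C ((catalan (d - 1 - k) * (d - 1 - k).choose k : ℕ) : ℤ) * (X - 1) ^ k
  else
    ∑ k ∈ Finset.range d,
      C (catalan (d - 1 - k) : ℤ) * (1 - X) ^ k * X ^ (d - k) *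
        ∑ s ∈ Finset.range (j + 1),
          C (if s ≤ k then (j.choose s * (d + i + j - 1 - k - s).choose (k - s) : ℤ) else 0)

/-! ### Noncrossing partitions -/

/-- A partition of a set of natural numbers is noncrossing if `a < b < c < e` with `a, c` in one
block and `b, e` in one block forces all four into the same block. -/
def IsNoncrossing {s : Finset ℕ} (π : Finpartition s) : Prop :=
  ∀ a b c e : ℕ, a < b → b < c → c < e →
    ∀ A ∈ π.parts, ∀ B ∈ π.parts, a ∈ A → c ∈ A → b ∈ B → e ∈ B → A = B

/-- The elements counted for the type `(i, j)`. The condition `v ≥ d - j` is written as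
`d ≤ v + j`. -/
def IsSpecial {s : Finset ℕ} (π : Finpartition s) (d i j v : ℕ) : Prop :=
  (∃ B ∈ π.parts, 1 < B.card ∧ IsLeast (B : Set ℕ) v) ∨
  ({v} ∈ π.parts ∧ (v ≤ i ∨ d ≤ v + j)) ∨
  (d ≤ v + j ∧ ∃ B ∈ π.parts, v ∈ B ∧ ¬ IsLeast (B : Set ℕ) v ∧
    (IsGreatest (B : Set ℕ) v → 1 ∈ B))

open Classical in
/-- The number of special elements of a partition. -/
noncomputable def specialCount {s : Finset ℕ} (π : Finpartition s) (d i j : ℕ) : ℕ :=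
  (s.filter fun v => IsSpecial π d i j v).card

/-! Put n = d - 1, w = x - 1, and let c be the Catalan series. Both the toric contribution and the
weighted count of noncrossing partitions turn out to be the coefficient of T^n in W(i,j) = x (1 -
wT)^i (1 - 2wT)^j c(xT(1 - wT)), which is `shellSeries i j`; expanding c in powers of its argument
gives the explicit sum for f_d(i,j,x) (`coeff_shellSeries`). Multiplication by 1 - wT or 1 - 2wT is
a two-term recursion in i or j, so for i ≥ 1 either side needs only these recursions and the case
(1,0) (`eq_coeff_shellSeries`).

Toric side. The g-polynomial of the n-cube is the coefficient of T^n in c(T(1 + wT))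
(`toricG_eq_cubeG`): it has degree at most n/2, and f·(x - 1) + g, a sum over all faces of the cube
including the empty one, is the coefficient of T^n in W(0,0), which is divisible by x^(⌊n/2⌋+1).
Faces of a cube are products over the coordinates. Recording a free coordinate by Z and a fixed one
by w, the faces outside the earlier facets have the generating polynomial Z^j (Z + w)^i (Z +
2w)^(n-i-j). Applying Z^m ↦ g(m-cube) gives the contribution (`sum_new_faces`), and Z + w = (Z + 2w)
- w, Z = (Z + 2w) - 2w are the recursions in i and j (`cubeGLin_prod`). Only the first component
also contributes the empty face.

Combinatorial side. Give each nonspecial element weight x and read a noncrossing partition from left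
to right, keeping the number of open blocks and whether the block of 1 is open. Merging the state
"block of 1 closed, h blocks open" with "block of 1 open and h others" yields Motzkin paths with
steps 1, 2x, x (`completionWeight_add_succ`). At positions at most i the level weight 2x drops by w,
and at the last j positions by 2w: the same recursions again (`X_mul_aeval_motzkinStep`). Type (0,0)
is treated separately (`X_mul_completionWeight_zero_zero`). Noncrossing partitions are encoded by
their block-minimum maps (`bijOn_blockMin`), in which a nonminimal element must join the innermost
open block. -/

/-! ### Compositions with the Catalan series -/

/-- The Catalan generating function, composed with a power series `u` without constant term. -/
noncomputable def catalanComp {R : Type*} [CommRing R] (u : PowerSeries R) : PowerSeries R :=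
  (PowerSeries.catalanSeries.map (Nat.castRingHom R)).subst u

/-- The quadratic equation of c survives substitution. The closed-form identities between series
below are deduced from it by linear combinations. -/
theorem catalanComp_eq {R : Type*} [CommRing R] {u : PowerSeries R}
    (hu : PowerSeries.constantCoeff u = 0) :
    catalanComp u = 1 + u * catalanComp u ^ 2 := by
  have hs : PowerSeries.HasSubst u := PowerSeries.HasSubst.of_constantCoeff_zero' hu
  have h := congrArg (fun f => (f.map (Nat.castRingHom R)).subst u)
    PowerSeries.catalanSeries_sq_mul_X_add_one
  simp only [map_add, map_mul, map_pow, PowerSeries.map_X, map_one] at h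
  rw [PowerSeries.subst_add hs, PowerSeries.subst_mul hs, PowerSeries.subst_pow hs,
    PowerSeries.subst_X hs] at h
  have h1 : PowerSeries.subst u (1 : PowerSeries R) = (1 : PowerSeries R) := by
    rw [← PowerSeries.coe_substAlgHom hs, map_one]
  rw [h1] at h
  rw [catalanComp]
  linear_combination -h

theorem PowerSeries.coeff_pow_eq_zero_of_lt {R : Type*} [CommRing R] {u : PowerSeries R}
    (hu : PowerSeries.constantCoeff u = 0) {k m : ℕ} (h : k < m) :
    PowerSeries.coeff k (u ^ m) = 0 := by
  obtain ⟨v, rfl⟩ := PowerSeries.X_dvd_iff.2 hu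
  rw [mul_pow, PowerSeries.coeff_X_pow_mul', if_neg (by omega)]

/-- Since u has no constant term, u ^ m does not reach degree n for m > n, so the infinite sum
truncates. -/
theorem PowerSeries.coeff_mul_subst {R : Type*} [CommRing R] {u : PowerSeries R}
    (hu : PowerSeries.constantCoeff u = 0) (A f : PowerSeries R) (n : ℕ) :
    PowerSeries.coeff n (A * f.subst u) =
      ∑ m ∈ Finset.range (n + 1), PowerSeries.coeff m f * PowerSeries.coeff n (A * u ^ m) := by
  have hs : PowerSeries.HasSubst u := PowerSeries.HasSubst.of_constantCoeff_zero' hu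
  have h : ∀ k ≤ n, PowerSeries.coeff k (f.subst u) =
      ∑ m ∈ Finset.range (n + 1), PowerSeries.coeff m f * PowerSeries.coeff k (u ^ m) := by
    intro k hk
    rw [PowerSeries.coeff_subst' hs]
    simp only [smul_eq_mul]
    apply finsum_eq_sum_of_support_subset
    intro m hm
    simp only [Finset.coe_range, Set.mem_Iio]
    by_contra hmn
    exact hm (by
      change _ * _ = _
      rw [PowerSeries.coeff_pow_eq_zero_of_lt hu (by omega), mul_zero])
  simp_rw [PowerSeries.coeff_mul, Finset.mul_sum]
  rw [Finset.sum_comm]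
  refine Finset.sum_congr rfl fun p hp => ?_
  rw [h p.2 (by have := Finset.HasAntidiagonal.mem_antidiagonal.1 hp; omega), Finset.mul_sum]
  exact Finset.sum_congr rfl fun m _ => by ring

/-- The coefficients of products of powers of `1 - w T` and `1 - 2 w T`. -/
theorem coeff_one_sub_pow_mul {R : Type*} [CommRing R] (w : R) (a j k : ℕ) :
    PowerSeries.coeff k ((1 - PowerSeries.C w * PowerSeries.X) ^ a *
        (1 - 2 * PowerSeries.C w * PowerSeries.X) ^ j : PowerSeries R) =
      (-w) ^ k * ∑ s ∈ Finset.range (j + 1),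
        (if s ≤ k then (j.choose s * (a + j - s).choose (k - s) : R) else 0) := by
  -- After rescaling T by -w the second factor is 1 + 2T = T + (1 + T). Its binomial expansion
  -- produces the index s and the coefficient `j.choose s`.
  have h1 : ((1 - PowerSeries.C w * PowerSeries.X) ^ a *
      (1 - 2 * PowerSeries.C w * PowerSeries.X) ^ j : PowerSeries R) =
      PowerSeries.rescale (-w) ((1 + PowerSeries.X) ^ a *
        (PowerSeries.X + (1 + PowerSeries.X)) ^ j) := by
    simp only [map_mul, map_pow, map_add, map_one, PowerSeries.rescale_X, map_neg]
    ring
  rw [h1, PowerSeries.coeff_rescale, add_pow (PowerSeries.X : PowerSeries R), Finset.mul_sum,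
    map_sum]
  congr 1
  refine Finset.sum_congr rfl fun s hs => ?_
  have hs' : s ≤ j := by simpa [Nat.lt_succ_iff] using hs
  have h2 : ((1 + PowerSeries.X) ^ a * (PowerSeries.X ^ s * (1 + PowerSeries.X) ^ (j - s) *
      (j.choose s : PowerSeries R))) = PowerSeries.X ^ s *
        (PowerSeries.C (j.choose s : R) *
        (((1 + X) ^ (a + j - s) : R[X]) : PowerSeries R)) := by
    have : a + j - s = a + (j - s) := by omega
    rw [this]
    have h3 : (((1 + X) ^ (a + (j - s)) : R[X]) : PowerSeries R) =
        (1 + PowerSeries.X) ^ (a + (j - s)) := by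
      rw [Polynomial.coe_pow, Polynomial.coe_add, Polynomial.coe_one, Polynomial.coe_X]
    rw [h3, map_natCast, pow_add]
    ring
  rw [h2, PowerSeries.coeff_X_pow_mul']
  split_ifs
  · rw [PowerSeries.coeff_C_mul, Polynomial.coeff_coe, Polynomial.coeff_one_add_X_pow]
  · rfl

/-! ### The series of the polynomials f_d(i, j, x) and its recursions -/

/-- The generating function, over the dimension, of the polynomials `f_d(i, j, x)`. -/
noncomputable def shellSeries (i j : ℕ) : PowerSeries ℤ[X] :=
  PowerSeries.C X * (1 - PowerSeries.C (X - 1) * PowerSeries.X) ^ i *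
    (1 - 2 * PowerSeries.C (X - 1) * PowerSeries.X) ^ j *
    catalanComp (PowerSeries.C X * PowerSeries.X * (1 - PowerSeries.C (X - 1) * PowerSeries.X))

theorem coeff_shellSeries (n i j : ℕ) :
    PowerSeries.coeff n (shellSeries i j) = ∑ k ∈ Finset.range (n + 1),
      C (catalan (n + 1 - 1 - k) : ℤ) * (1 - X) ^ k * X ^ (n + 1 - k) *
        ∑ s ∈ Finset.range (j + 1), C (if s ≤ k then
          (j.choose s * (n + 1 + i + j - 1 - k - s).choose (k - s) : ℤ) else 0) := by
  symm
  -- The index is reversed: m = n - k is the exponent of the Catalan argument, which supplies T^m,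
  -- x^m and a further (1 - wT)^m.
  rw [shellSeries, catalanComp, PowerSeries.coeff_mul_subst (by simp), ← Finset.sum_range_reflect]
  refine Finset.sum_congr rfl fun m hm => ?_
  have hm' : m ≤ n := by simpa [Nat.lt_succ_iff] using hm
  obtain ⟨k, rfl⟩ := Nat.exists_eq_add_of_le hm'
  have h1 : m + k + 1 - 1 - m = k := by omega
  have h2 : m + k + 1 - 1 - k = m := by omega
  have h3 : m + k + 1 - k = m + 1 := by omega
  have h4 : m + k + 1 + i + j - 1 - k = i + m + j := by omega
  rw [h1, h2, h3, h4]
  have h5 : (PowerSeries.C X * (1 - PowerSeries.C (X - 1) * PowerSeries.X) ^ i *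
      (1 - 2 * PowerSeries.C (X - 1) * PowerSeries.X) ^ j *
      (PowerSeries.C X * PowerSeries.X *
        (1 - PowerSeries.C (X - 1) * PowerSeries.X)) ^ m : PowerSeries ℤ[X]) =
      PowerSeries.X ^ m * (PowerSeries.C (X ^ (m + 1)) *
        ((1 - PowerSeries.C (X - 1) * PowerSeries.X) ^ (i + m) *
        (1 - 2 * PowerSeries.C (X - 1) * PowerSeries.X) ^ j)) := by
    rw [map_pow, mul_pow, mul_pow]
    ring
  rw [h5, PowerSeries.coeff_X_pow_mul', if_pos (by omega), Nat.add_sub_cancel_left,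
    PowerSeries.coeff_C_mul, coeff_one_sub_pow_mul, PowerSeries.coeff_map,
    PowerSeries.catalanSeries_coeff, neg_sub]
  have h6 : (∑ s ∈ Finset.range (j + 1),
      C (if s ≤ k then (j.choose s * (i + m + j - s).choose (k - s) : ℤ) else 0)) =
      ∑ s ∈ Finset.range (j + 1),
        (if s ≤ k then (j.choose s * (i + m + j - s).choose (k - s) : ℤ[X]) else 0) := by
    refine Finset.sum_congr rfl fun s _ => ?_
    split_ifs <;> simp
  rw [h6]
  simp only [eq_natCast, map_natCast]
  ring

theorem fPoly_eq_coeff_shellSeries {n i j : ℕ} (hj : j ≠ n) :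
    fPoly (n + 1) i j = PowerSeries.coeff n (shellSeries i j) := by
  rw [fPoly, if_neg (by simpa using hj), coeff_shellSeries]

/-- The k-th term carries x^(n+1-k), which suffices for k ≤ n/2. For larger k the binomial
coefficient (n-k choose k) vanishes. -/
theorem X_pow_dvd_coeff_shellSeries (n : ℕ) :
    X ^ (n / 2 + 1) ∣ PowerSeries.coeff n (shellSeries 0 0) := by
  rw [coeff_shellSeries]
  refine Finset.dvd_sum fun k hk => ?_
  by_cases h : k ≤ n / 2
  · exact ((pow_dvd_pow X (by omega)).mul_left _).mul_right _
  · rw [Finset.sum_range_one, if_pos (Nat.zero_le k), Nat.choose_eq_zero_of_lt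
      (show n + 1 + 0 + 0 - 1 - k - 0 < k - 0 by omega)]
    simp

theorem shellSeries_succ_left (i j : ℕ) :
    shellSeries (i + 1) j =
      (1 - PowerSeries.C (X - 1) * PowerSeries.X) * shellSeries i j := by
  rw [shellSeries, shellSeries]
  ring

theorem shellSeries_succ_right (i j : ℕ) :
    shellSeries i (j + 1) =
      (1 - 2 * PowerSeries.C (X - 1) * PowerSeries.X) * shellSeries i j := by
  rw [shellSeries, shellSeries]
  ring

theorem coeff_shellSeries_succ_left (n i j : ℕ) :
    PowerSeries.coeff (n + 1) (shellSeries (i + 1) j) =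
      PowerSeries.coeff (n + 1) (shellSeries i j) -
        (X - 1) * PowerSeries.coeff n (shellSeries i j) := by
  rw [shellSeries_succ_left, sub_mul, one_mul, map_sub, mul_assoc, PowerSeries.coeff_C_mul,
    PowerSeries.coeff_succ_X_mul]

theorem coeff_shellSeries_succ_right (n i j : ℕ) :
    PowerSeries.coeff (n + 1) (shellSeries i (j + 1)) =
      PowerSeries.coeff (n + 1) (shellSeries i j) -
        2 * (X - 1) * PowerSeries.coeff n (shellSeries i j) := by
  have : (2 * PowerSeries.C (X - 1) : PowerSeries ℤ[X]) = PowerSeries.C (2 * (X - 1)) := by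
    rw [map_mul, map_ofNat]
  rw [shellSeries_succ_right, this, sub_mul, one_mul, map_sub, mul_assoc, PowerSeries.coeff_C_mul,
    PowerSeries.coeff_succ_X_mul]

/-- A function of `(i, j, l)` that obeys the recursions of the coefficients of `shellSeries` in
`i` and `j` is determined by its values at `(1, 0, l)`. -/
theorem eq_coeff_shellSeries {Φ : ℕ → ℕ → ℕ → ℤ[X]}
    (h0 : ∀ l, Φ 1 0 l = PowerSeries.coeff (l + 1) (shellSeries 1 0))
    (hi : ∀ i l, 1 ≤ i → Φ (i + 1) 0 l = Φ i 0 (l + 1) - (X - 1) * Φ i 0 l)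
    (hj : ∀ i j l, 1 ≤ i → Φ i (j + 1) l = Φ i j (l + 1) - 2 * (X - 1) * Φ i j l)
    {i : ℕ} (h1 : 1 ≤ i) (j l : ℕ) :
    Φ i j l = PowerSeries.coeff (i + j + l) (shellSeries i j) := by
  induction j generalizing l with
  | zero =>
    induction i, h1 using Nat.le_induction generalizing l with
    | base => rw [h0, add_comm l 1]
    | succ i h1 ih =>
      rw [hi i l h1, ih, ih, show i + 1 + 0 + l = i + 0 + l + 1 by ring,
        coeff_shellSeries_succ_left]
      rfl
  | succ j ih =>
    rw [hj i j l h1, ih, ih, show i + (j + 1) + l = i + j + l + 1 by ring,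
      coeff_shellSeries_succ_right]
    rfl

/-- The series `K = ∑ f_d(1, 0, x) T^d` without its constant term solves the quadratic equation of
the Motzkin paths whose level and down steps have weights `2x` and `x`. -/
theorem shellSeries_one_zero_sub_quadratic :
    shellSeries 1 0 - PowerSeries.C X = PowerSeries.X * ((shellSeries 1 0 - PowerSeries.C X) ^ 2 +
      PowerSeries.C (2 * X) * (shellSeries 1 0 - PowerSeries.C X) + PowerSeries.C X) := by
  have h := catalanComp_eq (u := (PowerSeries.C X * PowerSeries.X *
    (1 - PowerSeries.C (X - 1) * PowerSeries.X) : PowerSeries ℤ[X])) (by simp)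
  rw [shellSeries]
  set c := catalanComp (PowerSeries.C X * PowerSeries.X *
    (1 - PowerSeries.C (X - 1) * PowerSeries.X) : PowerSeries ℤ[X])
  simp only [map_mul, map_sub, map_one, map_ofNat] at h ⊢
  -- Write S = x(1 - wT)c for the series of type (1,0). Multiplying the Catalan equation by x(1 -
  -- wT) gives S = x(1 - wT) + TS²; then substitute S = K + x.
  linear_combination (PowerSeries.C X *
    (1 - (PowerSeries.C X - 1) * PowerSeries.X) : PowerSeries ℤ[X]) * h

/-! ### The toric `g`-polynomial of the cube -/

/-- The toric `g`-polynomial of the `n`-cube. -/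
noncomputable def cubeG (n : ℕ) : ℤ[X] :=
  PowerSeries.coeff n (catalanComp
    (PowerSeries.X * (1 + PowerSeries.C (X - 1) * PowerSeries.X) : PowerSeries ℤ[X]))

/-- The m-th term is a multiple of (m choose n-m) (x - 1)^(n-m), which vanishes unless n - m ≤ m,
that is n - m ≤ n/2. -/
theorem natDegree_cubeG_le (n : ℕ) : (cubeG n).natDegree ≤ n / 2 := by
  have h := PowerSeries.coeff_mul_subst (u := (PowerSeries.X *
    (1 + PowerSeries.C (X - 1) * PowerSeries.X) : PowerSeries ℤ[X])) (by simp) 1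
    (PowerSeries.catalanSeries.map (Nat.castRingHom ℤ[X])) n
  rw [one_mul] at h
  rw [cubeG, catalanComp, h]
  refine natDegree_sum_le_of_forall_le _ _ fun m hm => ?_
  have hm' : m ≤ n := by simpa [Nat.lt_succ_iff] using hm
  have h2 := coeff_one_sub_pow_mul (-(X - 1) : ℤ[X]) m 0 (n - m)
  rw [pow_zero, mul_one, map_neg, neg_mul, sub_neg_eq_add, neg_neg] at h2
  rw [one_mul, mul_pow, PowerSeries.coeff_X_pow_mul', if_pos hm', h2, Finset.sum_range_one,
    if_pos (Nat.zero_le _), PowerSeries.coeff_map]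
  by_cases hk : n - m ≤ m
  · have h3 : (X - 1 : ℤ[X]).natDegree ≤ 1 := (natDegree_X_sub_C (1 : ℤ)).le
    have h4 : ∀ a b c : ℕ, ((Nat.castRingHom ℤ[X] a) *
        ((X - 1 : ℤ[X]) ^ (n - m) * ((b : ℤ[X]) * (c : ℤ[X])))).natDegree ≤ n - m := by
      intro a b c
      have : (Nat.castRingHom ℤ[X] a) *
          ((X - 1 : ℤ[X]) ^ (n - m) * ((b : ℤ[X]) * (c : ℤ[X]))) =
          C ((a * b * c : ℕ) : ℤ) * (X - 1) ^ (n - m) := by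
        simp
        ring
      rw [this]
      refine (natDegree_C_mul_le _ _).trans (natDegree_pow_le.trans ?_)
      nlinarith
    exact (h4 _ _ _).trans (by omega)
  · rw [Nat.choose_eq_zero_of_lt (show m + 0 - 0 < n - m - 0 by omega)]
    simp

/-- T^m / (1 - aT)^(m+1) is the generating function of the binomials in column m. A binomial
transform thus becomes a substitution, to which the quadratic equations apply. -/
theorem coeff_subst_geometric {R : Type*} [CommRing R] (a : R) (f : PowerSeries R) (l : ℕ) :
    PowerSeries.coeff l (PowerSeries.rescale a (PowerSeries.mk 1) *
      f.subst (PowerSeries.X * PowerSeries.rescale a (PowerSeries.mk 1))) =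
      ∑ m ∈ Finset.range (l + 1), a ^ (l - m) * l.choose m * PowerSeries.coeff m f := by
  rw [PowerSeries.coeff_mul_subst (by simp)]
  refine Finset.sum_congr rfl fun m hm => ?_
  have hm' : m ≤ l := by simpa [Nat.lt_succ_iff] using hm
  obtain ⟨k, rfl⟩ := Nat.exists_eq_add_of_le hm'
  have : PowerSeries.rescale a (PowerSeries.mk 1) *
      (PowerSeries.X * PowerSeries.rescale a (PowerSeries.mk 1)) ^ m =
      PowerSeries.X ^ m * PowerSeries.rescale a (PowerSeries.mk 1 ^ (m + 1)) := by
    rw [map_pow]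
    ring
  rw [this, PowerSeries.coeff_X_pow_mul', if_pos hm', PowerSeries.coeff_rescale,
    PowerSeries.mk_one_pow_eq_mk_choose_add, PowerSeries.coeff_mk, Nat.add_sub_cancel_left]
  ring

theorem one_sub_mul_rescale_mk_one {R : Type*} [CommRing R] (a : R) :
    (1 - PowerSeries.C a * PowerSeries.X) * PowerSeries.rescale a (PowerSeries.mk 1) = 1 := by
  have := congrArg (PowerSeries.rescale a) (PowerSeries.mk_one_mul_one_sub_eq_one R)
  rw [map_mul, map_sub, map_one, PowerSeries.rescale_X] at this
  rw [mul_comm]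
  exact this

/-- The binomial transform of the polynomials `cubeG` gives the polynomials `f_d(0, 0, x)`. -/
theorem sum_cubeG_add_pow (l : ℕ) :
    (∑ m ∈ Finset.range (l + 1), (2 * (X - 1)) ^ (l - m) * (l.choose m : ℤ[X]) * cubeG m) +
      (X - 1) ^ (l + 1) = PowerSeries.coeff l (shellSeries 0 0) := by
  have hG := catalanComp_eq (u := (PowerSeries.X *
    (1 + PowerSeries.C (X - 1) * PowerSeries.X) : PowerSeries ℤ[X])) (by simp)
  have hc := catalanComp_eq (u := (PowerSeries.C X * PowerSeries.X *
    (1 - PowerSeries.C (X - 1) * PowerSeries.X) : PowerSeries ℤ[X])) (by simp)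
  simp only [cubeG]
  rw [← coeff_subst_geometric, shellSeries]
  set G := catalanComp (PowerSeries.X *
    (1 + PowerSeries.C (X - 1) * PowerSeries.X) : PowerSeries ℤ[X])
  set c := catalanComp (PowerSeries.C X * PowerSeries.X *
    (1 - PowerSeries.C (X - 1) * PowerSeries.X) : PowerSeries ℤ[X])
  have hS := one_sub_mul_rescale_mk_one (2 * (X - 1) : ℤ[X])
  have hS' := one_sub_mul_rescale_mk_one (X - 1 : ℤ[X])
  set S := PowerSeries.rescale (2 * (X - 1) : ℤ[X]) (PowerSeries.mk 1)
  have hs : PowerSeries.HasSubst (PowerSeries.X * S) :=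
    PowerSeries.HasSubst.of_constantCoeff_zero' (by simp)
  have hG' := congrArg (PowerSeries.substAlgHom (R := ℤ[X]) hs) hG
  have hC : ∀ p : ℤ[X], PowerSeries.substAlgHom (R := ℤ[X]) hs (PowerSeries.C p) =
      PowerSeries.C p := fun p => by
    rw [PowerSeries.coe_substAlgHom]
    exact PowerSeries.subst_C p
  simp only [map_add, map_mul, map_pow, map_one, hC, PowerSeries.substAlgHom_X] at hG'
  rw [PowerSeries.coe_substAlgHom] at hG'
  set G' := G.subst (PowerSeries.X * S)
  have hpow : (X - 1 : ℤ[X]) ^ (l + 1) = PowerSeries.coeff l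
      (PowerSeries.C (X - 1) * PowerSeries.rescale (X - 1 : ℤ[X]) (PowerSeries.mk 1)) := by
    rw [PowerSeries.coeff_C_mul, PowerSeries.coeff_rescale, PowerSeries.coeff_mk, pow_succ']
    simp
  set S' := PowerSeries.rescale (X - 1 : ℤ[X]) (PowerSeries.mk 1)
  rw [hpow, ← map_add]
  congr 1
  have hx : (PowerSeries.C X : PowerSeries ℤ[X]) = PowerSeries.C (X - 1) + 1 := by simp
  have h2 : (PowerSeries.C (2 * (X - 1)) : PowerSeries ℤ[X]) = 2 * PowerSeries.C (X - 1) := by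
    rw [map_mul, map_ofNat]
  rw [h2] at hS
  rw [hx] at hc ⊢
  generalize (PowerSeries.C (X - 1) : PowerSeries ℤ[X]) = w at *
  -- V = S * G' is the binomial transform of the cube series, with S = 1/(1 - 2wT). Its quadratic
  -- equation is that of G after T ↦ TS, cleared of denominators.
  have hV : (1 - 2 * w * PowerSeries.X) * (S * G') =
      1 + PowerSeries.X * (1 - w * PowerSeries.X) * (S * G') ^ 2 := by
    linear_combination G' * hS + hG' - PowerSeries.X * G' ^ 2 * S * hS
  -- Both V + w/(1 - wT) and (w + 1)c solve Y = (w + 1) + T(1 - wT)Y². The difference of the two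
  -- equations factors, and the second factor has constant term 1, hence is a unit.
  have hU : S * G' + w * S' - (w + 1) * c = 0 := by
    have hD : (S * G' + w * S' - (w + 1) * c) * (1 - PowerSeries.X * (1 - w * PowerSeries.X) *
        (S * G' + w * S' + (w + 1) * c)) = 0 := by
      linear_combination hV - 2 * w * PowerSeries.X * (S * G') * hS' -
        PowerSeries.X * w ^ 2 * S' * hS' + w * hS' - (w + 1) * hc
    refine (IsUnit.mul_left_eq_zero ?_).1 hD
    rw [PowerSeries.isUnit_iff_constantCoeff]
    simp
  linear_combination hU

/-! ### Faces of cubes -/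

instance (n : ℕ) : Fintype (CubeFace n) := inferInstanceAs (Fintype (Fin n → Option Bool))

open Classical in
/-- The dimension of a face of the cube: the number of its free coordinates. -/
noncomputable def CubeFace.dim {n : ℕ} (c : CubeFace n) : ℕ :=
  (Finset.univ.filter fun k : Fin n => c k = none).card

theorem CubeFace.dim_strictMono (n : ℕ) : StrictMono (CubeFace.dim (n := n)) := by
  intro a b hab
  apply Finset.card_lt_card
  refine ⟨fun k hk => ?_, fun h => hab.not_ge fun k => ?_⟩
  · simp only [Finset.mem_filter, Finset.mem_univ, true_and] at hk ⊢
    rcases hab.le k with h | h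
    · exact h
    · rw [← h, hk]
  · rcases hab.le k with h' | h'
    · left
      have := h (show k ∈ _ by simpa using h')
      simpa using this
    · exact Or.inr h'.symm

open Classical in
theorem CubeFace.height_eq_dim {n : ℕ} (c : CubeFace n) : Order.height c = c.dim := by
  apply le_antisymm
  · simpa using Order.height_le_height_apply_of_strictMono _ (CubeFace.dim_strictMono n) c
  · induction hm : c.dim generalizing c with
    | zero => simp
    | succ m ih =>
      obtain ⟨k, hk⟩ : (Finset.univ.filter fun k : Fin n => c k = none).Nonempty := by
        rw [← Finset.card_pos]
        change 0 < c.dim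
        omega
      have hk' : c k = none := by simpa using hk
      obtain ⟨c', h1, h2⟩ : ∃ c' : CubeFace n, c' k = some false ∧ ∀ l, l ≠ k → c' l = c l :=
        ⟨Function.update (c : Fin n → Option Bool) k (some false), Function.update_self _ _ _,
          fun l hl => Function.update_of_ne hl _ _⟩
      have hlt : c' < c := by
        refine ⟨fun l => ?_, fun h => ?_⟩
        · by_cases hl : l = k
          · subst hl
            exact Or.inl hk'
          · exact Or.inr (h2 l hl)
        · rcases h k with h' | h'
          · rw [h1] at h'
            cases h'
          · rw [h1, hk'] at h'
            cases h'
      have hdim : c'.dim = m := by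
        have : (Finset.univ.filter fun l : Fin n => c' l = none) =
            (Finset.univ.filter fun l : Fin n => c l = none).erase k := by
          ext l
          rw [Finset.mem_erase, Finset.mem_filter, Finset.mem_filter]
          by_cases hl : l = k
          · subst hl
            rw [h1]
            simp
          · rw [h2 l hl]
            simp [hl]
        refine (congrArg Finset.card this).trans ?_
        rw [Finset.card_erase_of_mem hk]
        change c.dim - 1 = m
        omega
      calc ((m + 1 : ℕ) : ℕ∞) = (m : ℕ∞) + 1 := by push_cast; rfl
        _ ≤ Order.height c' + 1 := by gcongr; exact ih c' hdim
        _ ≤ Order.height c := Order.height_add_one_le hlt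

/-- The cube itself, as a face. -/
def CubeFace.whole (n : ℕ) : CubeFace n := fun _ => none

theorem CubeFace.le_whole {n : ℕ} (c : CubeFace n) : c ≤ CubeFace.whole n := fun _ => Or.inl rfl

theorem CubeFace.dim_whole (n : ℕ) : (CubeFace.whole n).dim = n := by
  simp [CubeFace.dim, CubeFace.whole]

/-- Sums of products over the faces of a cube. -/
theorem CubeFace.sum_prod {n : ℕ} {R : Type*} [CommSemiring R] (y : Fin n → Option Bool → R) :
    ∑ c : CubeFace n, ∏ k, y k (c k) = ∏ k, (y k none + (y k (some true) + y k (some false))) := by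
  have := (Finset.prod_univ_sum (fun _ : Fin n => (Finset.univ : Finset (Option Bool))) y).symm
  rw [Fintype.piFinset_univ] at this
  refine Eq.trans this (Finset.prod_congr rfl fun k _ => ?_)
  rw [Fintype.sum_option, Fintype.sum_bool]

/-! ### Ranks of faces -/

section rank

variable {P : Type*} [PartialOrder P]

theorem height_subtype_Iic {b : P} (a : Set.Iic b) : Order.height a.1 = Order.height a := by
  symm
  apply Order.height_eq_of_strictMono (fun a : Set.Iic b => a.1) (fun _ _ h => h)
  intro a' y hy
  exact ⟨⟨y, hy.le.trans a'.2⟩, hy, rfl⟩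

theorem height_eq_of_orderIso {b : P} {n : ℕ} (e : Set.Iic b ≃o WithBot (CubeFace n))
    {a : Set.Iic b} {c : CubeFace n} (h : e a = c) : Order.height a.1 = (c.dim + 1 : ℕ) := by
  rw [height_subtype_Iic, ← Order.height_orderIso e, h, Order.height_coe_withBot,
    CubeFace.height_eq_dim]
  rfl

theorem posetRank_eq_of_orderIso {b : P} {n : ℕ} (e : Set.Iic b ≃o WithBot (CubeFace n))
    {a : Set.Iic b} {c : CubeFace n} (h : e a = c) : posetRank a.1 = c.dim + 1 := by
  rw [posetRank, height_eq_of_orderIso e h]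
  exact ENat.toNat_natCast (c.dim + 1)

theorem orderIso_self {b : P} {n : ℕ} (e : Set.Iic b ≃o WithBot (CubeFace n)) :
    e ⟨b, le_rfl⟩ = (CubeFace.whole n : WithBot (CubeFace n)) := by
  apply le_antisymm
  · rcases h : e ⟨b, le_rfl⟩ with _ | c
    · exact bot_le
    · exact WithBot.coe_le_coe.2 c.le_whole
  · rw [← e.symm_apply_le]
    exact (e.symm _).2

theorem height_of_orderIso {b : P} {n : ℕ} (e : Set.Iic b ≃o WithBot (CubeFace n)) :
    Order.height b = (n + 1 : ℕ) := by
  rw [height_eq_of_orderIso e (orderIso_self e), CubeFace.dim_whole]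

theorem posetRank_of_orderIso {b : P} {n : ℕ} (e : Set.Iic b ≃o WithBot (CubeFace n)) :
    posetRank b = n + 1 := by
  rw [posetRank_eq_of_orderIso e (orderIso_self e), CubeFace.dim_whole]

theorem posetRank_bot [OrderBot P] : posetRank (⊥ : P) = 0 := by
  simp [posetRank]

end rank

/-! ### Sums over cube faces as values of a linear functional -/

/-- The linear map with `Z ^ m ↦ cubeG m`. -/
noncomputable def cubeGLin : ℤ[X][X] →ₗ[ℤ[X]] ℤ[X] :=
  Polynomial.lsum fun m => LinearMap.mulRight ℤ[X] (cubeG m)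

theorem cubeGLin_C_mul_X_pow (a : ℤ[X]) (m : ℕ) : cubeGLin (C a * X ^ m) = a * cubeG m := by
  rw [cubeGLin, C_mul_X_pow_eq_monomial, Polynomial.lsum_apply, Polynomial.sum_monomial_index]
  · simp
  · simp

open Classical in
/-- The sum of `g(c) (x - 1) ^ (n - dim c)` over the faces `c` of the `n`-cube that lie in none of
the facets in `S`. -/
theorem sum_cubeG_dim {n : ℕ} (S : Finset (Fin n × Bool)) :
    ∑ c : CubeFace n with ¬ ∃ p ∈ S, c ≤ cubeFacet p, cubeG c.dim * (X - 1) ^ (n - c.dim) =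
      cubeGLin (∏ k, (X + ((if (k, true) ∈ S then 0 else C (X - 1)) +
        (if (k, false) ∈ S then 0 else C (X - 1))))) := by
  -- Coordinate weights: Z if free, w if fixed, but 0 if fixed on a facet of S. The product
  -- therefore vanishes exactly on the faces to be left out.
  let y : Fin n → Option Bool → ℤ[X][X] := fun k o =>
    o.elim X fun b => if (k, b) ∈ S then 0 else C (X - 1)
  have h := CubeFace.sum_prod y
  refine Eq.trans ?_ (congrArg cubeGLin h)
  rw [map_sum, Finset.sum_filter]
  refine Finset.sum_congr rfl fun c _ => ?_
  by_cases hc : ∃ p ∈ S, c ≤ cubeFacet p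
  · obtain ⟨p, hp, hle⟩ := hc
    rw [if_neg (not_not.2 ⟨p, hp, hle⟩)]
    have hcp : c p.1 = some p.2 := by
      rcases hle p.1 with h' | h'
      · simp [cubeFacet] at h'
      · simpa [cubeFacet] using h'
    rw [Finset.prod_eq_zero (Finset.mem_univ p.1), map_zero]
    rw [hcp]
    exact if_pos hp
  · rw [if_pos hc, ← Finset.prod_filter_mul_prod_filter_not Finset.univ (fun k : Fin n => c k = none)]
    have h1 : ∏ k with c k = none, y k (c k) = (X : ℤ[X][X]) ^ c.dim := by
      rw [CubeFace.dim, ← Finset.prod_const]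
      refine Finset.prod_congr rfl fun k hk => ?_
      rw [(Finset.mem_filter.1 hk).2]
      rfl
    have h2 : ∏ k with ¬ c k = none, y k (c k) = C (X - 1) ^ (n - c.dim) := by
      have hcard : (Finset.univ.filter fun k : Fin n => ¬ c k = none).card = n - c.dim := by
        have := Finset.card_filter_add_card_filter_not (s := Finset.univ) (fun k : Fin n => c k = none)
        rw [Finset.card_univ, Fintype.card_fin] at this
        rw [CubeFace.dim]
        omega
      rw [← hcard, ← Finset.prod_const]
      refine Finset.prod_congr rfl fun k hk => ?_
      obtain ⟨b, hb⟩ := Option.ne_none_iff_exists'.1 (Finset.mem_filter.1 hk).2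
      rw [hb]
      refine if_neg fun hS => hc ⟨(k, b), hS, fun l => ?_⟩
      by_cases hl : l = k
      · subst hl
        exact Or.inr (by simp [cubeFacet, hb])
      · exact Or.inl (by simp [cubeFacet, hl])
    rw [h1, h2, mul_comm (X ^ _), ← C_pow, cubeGLin_C_mul_X_pow, mul_comm]

/-! ### The toric polynomials of cubical posets -/

/-- The differences k_l - k_(l-1) are the coefficients of f·(1 - x), so the divisibility says that g
agrees with f·(1 - x) up to degree n/2, and the degree bound excludes anything further. -/
theorem truncatedDiff_eq {n : ℕ} {f g : ℤ[X]} (hg : g.natDegree ≤ n / 2)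
    (h : X ^ (n / 2 + 1) ∣ f * (X - 1) + g) : truncatedDiff n f = g := by
  ext i
  rw [truncatedDiff, finsetSum_coeff]
  simp only [coeff_C_mul, coeff_X_pow, mul_ite, mul_one, mul_zero]
  rw [Finset.sum_ite_eq]
  split_ifs with hi hi0
  · have := (X_pow_dvd_iff.1 h) i (by simpa using hi)
    subst hi0
    rw [coeff_add, mul_coeff_zero] at this
    simp at this
    linarith
  · obtain ⟨k, rfl⟩ := Nat.exists_eq_succ_of_ne_zero hi0
    have := (X_pow_dvd_iff.1 h) _ (Finset.mem_range.1 hi)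
    rw [mul_sub, mul_one, coeff_add, coeff_sub, coeff_mul_X] at this
    rw [Nat.succ_eq_add_one, Nat.add_sub_cancel]
    linarith
  · rw [coeff_eq_zero_of_natDegree_lt]
    simp at hi
    omega

/-- The summand (x - 1)^(n+1) is the contribution of the empty face, which is not a `CubeFace`. -/
theorem sum_cubeG_dim_univ (n : ℕ) :
    ∑ c : CubeFace n, cubeG c.dim * (X - 1) ^ (n - c.dim) + (X - 1) ^ (n + 1) =
      PowerSeries.coeff n (shellSeries 0 0) := by
  have h := sum_cubeG_dim (∅ : Finset (Fin n × Bool))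
  simp only [Finset.notMem_empty, false_and, exists_false, not_false_eq_true,
    Finset.filter_true, if_false, Finset.prod_const, Finset.card_univ, Fintype.card_fin] at h
  rw [h, ← sum_cubeG_add_pow, ← C_add, add_pow, map_sum]
  refine congrArg₂ (· + ·) (Finset.sum_congr rfl fun m _ => ?_) rfl
  rw [← cubeGLin_C_mul_X_pow]
  refine congrArg cubeGLin ?_
  simp only [map_mul, map_pow, map_natCast, map_sub, map_one, map_ofNat, C_add]
  ring

theorem cubeGLin_X_add_pow (l : ℕ) :
    cubeGLin ((X + C (2 * (X - 1))) ^ l) + (X - 1) ^ (l + 1) =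
      PowerSeries.coeff l (shellSeries 0 0) := by
  rw [← sum_cubeG_add_pow, add_pow, map_sum]
  refine congrArg₂ (· + ·) (Finset.sum_congr rfl fun m _ => ?_) rfl
  rw [← cubeGLin_C_mul_X_pow]
  refine congrArg cubeGLin ?_
  simp only [map_mul, map_pow, map_natCast, map_sub, map_one, map_ofNat]
  ring

/-- The identities Z + w = (Z + 2w) - w and Z = (Z + 2w) - 2w match the recursions of the series.
One factor Z + w is required: it makes the empty-face terms (x - 1)^(l+2) and (x - 1)·(x - 1)^(l+1)
cancel in the base case. -/
theorem cubeGLin_prod {i : ℕ} (hi : 1 ≤ i) (j l : ℕ) :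
    cubeGLin (X ^ j * (X + C (X - 1)) ^ i * (X + C (2 * (X - 1))) ^ l) =
      PowerSeries.coeff (i + j + l) (shellSeries i j) := by
  have hmul : ∀ (a : ℤ[X]) (p : ℤ[X][X]), cubeGLin (C a * p) = a * cubeGLin p := by
    intro a p
    rw [← smul_eq_C_mul, map_smul, smul_eq_mul]
  refine eq_coeff_shellSeries (Φ := fun i j l =>
    cubeGLin (X ^ j * (X + C (X - 1)) ^ i * (X + C (2 * (X - 1))) ^ l)) ?_ ?_ ?_ hi j l
  · intro l
    have h : (X ^ 0 * (X + C (X - 1)) ^ 1 * (X + C (2 * (X - 1))) ^ l : ℤ[X][X]) =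
        (X + C (2 * (X - 1))) ^ (l + 1) - C (X - 1) * (X + C (2 * (X - 1))) ^ l := by
      simp only [map_mul, map_ofNat]
      ring
    rw [h, map_sub, hmul]
    have h1 := cubeGLin_X_add_pow l
    have h2 := cubeGLin_X_add_pow (l + 1)
    rw [coeff_shellSeries_succ_left]
    linear_combination h2 - (X - 1) * h1
  · intro i l _
    rw [← hmul, ← map_sub]
    refine congrArg cubeGLin ?_
    simp only [map_mul, map_ofNat]
    ring
  · intro i j l _
    rw [← hmul, ← map_sub]
    refine congrArg cubeGLin ?_
    simp only [map_mul, map_ofNat]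
    ring

section poset

variable {P : Type*} [Fintype P]

/-- The nonempty faces below `b` are those of a cube. -/
theorem sum_faces [PartialOrder P] [OrderBot P] {M : Type*} [AddCommMonoid M] {b : P} {n : ℕ}
    (e : Set.Iic b ≃o WithBot (CubeFace n)) (Q : P → Prop) (φ : P → M)
    [DecidablePred fun a => a ≤ b ∧ a ≠ ⊥ ∧ Q a]
    [DecidablePred fun c : CubeFace n => Q (e.symm (c : WithBot (CubeFace n))).1] :
    ∑ a with a ≤ b ∧ a ≠ ⊥ ∧ Q a, φ a =
      ∑ c ∈ Finset.univ.filter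
        (fun c : CubeFace n => Q (e.symm (c : WithBot (CubeFace n))).1), φ (e.symm (c : WithBot (CubeFace n))).1 := by
  symm
  have hbot : (e.symm ⊥).1 = ⊥ := by
    have : e.symm ⊥ ≤ ⟨⊥, bot_le⟩ := by
      rw [e.symm_apply_le]
      exact bot_le
    exact le_bot_iff.1 this
  refine Finset.sum_bij (fun c _ => (e.symm (c : WithBot (CubeFace n))).1) ?_ ?_ ?_ (fun _ _ => rfl)
  · intro c hc
    refine Finset.mem_filter.2 ⟨Finset.mem_univ _, (e.symm (c : WithBot (CubeFace n))).2, fun h => ?_,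
      (Finset.mem_filter.1 hc).2⟩
    have : e.symm (c : WithBot (CubeFace n)) = e.symm ⊥ := Subtype.ext (h.trans hbot.symm)
    exact WithBot.coe_ne_bot (e.symm.injective this)
  · intro c _ c' _ h
    exact WithBot.coe_injective (e.symm.injective (Subtype.ext h))
  · intro a ha
    obtain ⟨-, hab, hne, hQ⟩ := Finset.mem_filter.1 ha
    have h : e ⟨a, hab⟩ ≠ ⊥ := by
      intro h
      apply hne
      rw [← hbot, ← h, OrderIso.symm_apply_apply]
    obtain ⟨c, hc⟩ := WithBot.ne_bot_iff_exists.1 h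
    have hca : (e.symm (c : WithBot (CubeFace n))).1 = a := by
      rw [hc, OrderIso.symm_apply_apply]
    refine ⟨c, ?_, hca⟩
    rw [Finset.mem_filter, hca]
    exact ⟨Finset.mem_univ _, hQ⟩

omit [Fintype P] in
theorem posetRank_symm [PartialOrder P] {b : P} {n : ℕ}
    (e : Set.Iic b ≃o WithBot (CubeFace n)) (c : CubeFace n) :
    posetRank (e.symm (c : WithBot (CubeFace n))).1 = c.dim + 1 :=
  posetRank_eq_of_orderIso e (e.apply_symm_apply _)

/-- By induction the proper faces have the expected g. Multiplying f by x - 1 and adding the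
candidate for the whole cube completes the sum over all faces, whose low coefficients vanish;
`truncatedDiff_eq` then identifies g. -/
theorem toricG_eq_cubeG [SemilatticeInf P] [OrderBot P] (hP : IsCubicalComplex P) (a : P)
    (ha : a ≠ ⊥) : toricG a = cubeG (posetRank a - 1) := by
  classical
  induction a using WellFoundedLT.induction with
  | _ a ih =>
    obtain ⟨n, ⟨e⟩⟩ := hP a ha
    have hr := posetRank_of_orderIso e
    rw [toricG_eq, if_neg ha, hr, Nat.add_sub_cancel]
    refine truncatedDiff_eq (natDegree_cubeG_le n) ?_
    have h1 : (∑ s : {s : P // s < a}, toricG s.1 * (X - 1) ^ (n - posetRank s.1)) =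
        (X - 1) ^ n + ∑ s with s ≤ a ∧ s ≠ ⊥ ∧ s ≠ a,
          cubeG (posetRank s - 1) * (X - 1) ^ (n - posetRank s) := by
      rw [← Finset.sum_subtype (Finset.univ.filter (· < a)) (by simp)
        (fun s => toricG s * (X - 1) ^ (n - posetRank s))]
      rw [← Finset.add_sum_erase _ _ (show ⊥ ∈ _ by simpa using bot_lt_iff_ne_bot.2 ha)]
      congr 1
      · rw [toricG_eq, if_pos rfl, posetRank_bot, one_mul, Nat.sub_zero]
      · refine Finset.sum_congr ?_ fun s hs => ?_
        · ext s
          simp only [Finset.mem_erase, Finset.mem_filter, Finset.mem_univ, true_and,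
            lt_iff_le_and_ne]
          tauto
        · simp only [Finset.mem_filter, Finset.mem_univ, true_and] at hs
          rw [ih s (lt_of_le_of_ne hs.1 hs.2.2) hs.2.1]
    have htop : ∀ c : CubeFace n, (e.symm (c : WithBot (CubeFace n))).1 ≠ a ↔ c ≠ CubeFace.whole n := by
      intro c
      rw [not_iff_not]
      have h := orderIso_self e
      rw [← e.eq_symm_apply] at h
      constructor
      · intro hc
        exact WithBot.coe_injective (e.symm.injective ((Subtype.ext hc).trans h))
      · rintro rfl
        rw [← h]
    have h2 : (∑ s with s ≤ a ∧ s ≠ ⊥ ∧ s ≠ a,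
          cubeG (posetRank s - 1) * (X - 1) ^ (n - posetRank s)) * (X - 1) + cubeG n =
        ∑ c : CubeFace n, cubeG c.dim * (X - 1) ^ (n - c.dim) := by
      rw [sum_faces e (fun s => s ≠ a) (fun s => cubeG (posetRank s - 1) *
        (X - 1) ^ (n - posetRank s)), Finset.sum_mul,
        ← Finset.add_sum_erase _ _ (Finset.mem_univ (CubeFace.whole n)), CubeFace.dim_whole,
        Nat.sub_self, pow_zero, mul_one, add_comm]
      congr 1
      refine Finset.sum_congr ?_ fun c hc => ?_
      · ext c
        simp [htop]
      · have hc' : c.dim < n := by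
          have := CubeFace.dim_strictMono n (lt_of_le_of_ne c.le_whole (Finset.ne_of_mem_erase hc))
          rwa [CubeFace.dim_whole] at this
        rw [posetRank_symm, Nat.add_sub_cancel, mul_assoc, ← pow_succ,
          show n - (c.dim + 1) + 1 = n - c.dim by omega]
    have h3 := sum_cubeG_dim_univ n
    rw [h1, add_mul, add_assoc, h2, ← pow_succ,
      show (X - 1 : ℤ[X]) ^ (n + 1) + _ = _ from (add_comm _ _).trans h3]
    exact X_pow_dvd_coeff_shellSeries n

omit [Fintype P] in
theorem posetRank_le [PartialOrder P] {a b : P} {d : ℕ} (hab : a ≤ b) (hb : Order.height b = d) :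
    posetRank a ≤ d := by
  rw [posetRank]
  exact ENat.toNat_le_of_le_natCast (hb ▸ Order.height_mono hab)

open Classical in
/-- The toric polynomial of a lower set whose maximal elements all have rank `d`. -/
theorem toricF_eq_sum [PartialOrder P] [OrderBot P] {ι : Type*} {F : ι → P} {d : ℕ} {p : ι → Prop}
    (hF : ∀ u, Order.height (F u) = d) :
    toricF {a | ∃ u, p u ∧ a ≤ F u} =
      ∑ a with ∃ u, p u ∧ a ≤ F u, toricG a * (X - 1) ^ (d - posetRank a) := by
  rw [toricF]
  refine Finset.sum_congr (by ext; simp) fun a ha => ?_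
  obtain ⟨u, hu, hau⟩ : ∃ u, p u ∧ a ≤ F u := by simpa using ha
  congr 3
  apply le_antisymm
  · refine Finset.sup_le fun s hs => ?_
    obtain ⟨v, hv, hsv⟩ : ∃ u, p u ∧ s ≤ F u := by simpa using hs
    exact posetRank_le hsv (hF v)
  · have h : posetRank (F u) = d := by
      rw [posetRank, hF u]
      exact ENat.toNat_natCast d
    rw [← h]
    exact Finset.le_sup (f := posetRank) (by simpa using ⟨u, hu, le_rfl⟩)

end poset

/-! ### The new faces of a shelling component -/

theorem card_filter_xor {n : ℕ} (S : Finset (Fin n × Bool)) :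
    (Finset.univ.filter fun k => ¬ ((k, true) ∈ S ↔ (k, false) ∈ S)).card =
      antipodallyUnpaired S := by
  symm
  refine Finset.card_bij (fun p _ => p.1) ?_ ?_ ?_
  · rintro ⟨k, b⟩ hp
    cases b <;> simp_all
  · rintro ⟨k, b⟩ hp ⟨k', b'⟩ hp' h
    cases b <;> cases b' <;> simp_all
  · intro k hk
    by_cases h : (k, true) ∈ S
    · exact ⟨(k, true), by simp_all, rfl⟩
    · exact ⟨(k, false), by simp_all, rfl⟩

/-- The product over the coordinates, by the number of antipodal pairs and of unpaired facets. -/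
theorem prod_facets {n : ℕ} {R : Type*} [CommRing R] (S : Finset (Fin n × Bool)) (z w : R) :
    ∏ k, (z + ((if (k, true) ∈ S then 0 else w) + (if (k, false) ∈ S then 0 else w))) =
      z ^ antipodalPairs S * (z + w) ^ antipodallyUnpaired S *
        (z + 2 * w) ^ (n - antipodallyUnpaired S - antipodalPairs S) := by
  rw [← Finset.prod_filter_mul_prod_filter_not Finset.univ
    (fun k => (k, false) ∈ S ∧ (k, true) ∈ S)]
  rw [← Finset.prod_filter_mul_prod_filter_not
    (Finset.univ.filter fun k => ¬ ((k, false) ∈ S ∧ (k, true) ∈ S))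
    (fun k => ¬ ((k, true) ∈ S ↔ (k, false) ∈ S))]
  have e1 : (Finset.univ.filter fun k => ¬ ((k, false) ∈ S ∧ (k, true) ∈ S)).filter
      (fun k => ¬ ((k, true) ∈ S ↔ (k, false) ∈ S)) =
      Finset.univ.filter (fun k => ¬ ((k, true) ∈ S ↔ (k, false) ∈ S)) := by
    ext k
    simp only [Finset.mem_filter, Finset.mem_univ, true_and]
    tauto
  have hc1 := Finset.card_filter_add_card_filter_not (s := Finset.univ)
    (fun k : Fin n => (k, false) ∈ S ∧ (k, true) ∈ S)
  have hc2 := Finset.card_filter_add_card_filter_not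
    (s := Finset.univ.filter fun k => ¬ ((k, false) ∈ S ∧ (k, true) ∈ S))
    (fun k => ¬ ((k, true) ∈ S ↔ (k, false) ∈ S))
  rw [Finset.card_univ, Fintype.card_fin] at hc1
  rw [e1, card_filter_xor] at hc2
  have hpair : (Finset.univ.filter fun k : Fin n => (k, false) ∈ S ∧ (k, true) ∈ S).card =
      antipodalPairs S := rfl
  rw [hpair] at hc1
  rw [e1, mul_assoc]
  congr 1
  · rw [← hpair]
    refine Finset.prod_eq_pow_card fun k hk => ?_
    simp only [Finset.mem_filter, Finset.mem_univ, true_and] at hk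
    simp [hk.1, hk.2]
  congr 1
  · rw [← card_filter_xor]
    refine Finset.prod_eq_pow_card fun k hk => ?_
    simp only [Finset.mem_filter, Finset.mem_univ, true_and] at hk
    split_ifs <;> simp_all
  · rw [show n - antipodallyUnpaired S - antipodalPairs S =
      ((Finset.univ.filter fun k => ¬ ((k, false) ∈ S ∧ (k, true) ∈ S)).filter
        fun k => ¬ ¬ ((k, true) ∈ S ↔ (k, false) ∈ S)).card by omega]
    refine Finset.prod_eq_pow_card fun k hk => ?_
    simp only [Finset.mem_filter, Finset.mem_univ, true_and] at hk
    split_ifs <;> first | (exfalso; tauto) | ring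

theorem antipodallyUnpaired_add_antipodalPairs_le {n : ℕ} (S : Finset (Fin n × Bool)) :
    antipodallyUnpaired S + antipodalPairs S ≤ n := by
  rw [← card_filter_xor, antipodalPairs, ← Finset.card_union_of_disjoint]
  · exact (Finset.card_le_univ _).trans (Fintype.card_fin n).le
  · rw [Finset.disjoint_filter]
    tauto

open Classical in
/-- The sum over the new faces of a component. -/
theorem sum_new_faces {P : Type*} [Fintype P] [SemilatticeInf P] [OrderBot P]
    (hP : IsCubicalComplex P) {n : ℕ} {b : P} (e : Set.Iic b ≃o WithBot (CubeFace n))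
    (S : Finset (Fin n × Bool)) (Q : P → Prop) (hS : ∀ a : Set.Iic b, e a ≠ ⊥ →
      (Q a.1 ↔ ∃ p ∈ S, e a ≤ (cubeFacet p : CubeFace n))) :
    ∑ a with a ≤ b ∧ a ≠ ⊥ ∧ ¬ Q a, toricG a * (X - 1) ^ (n + 1 - posetRank a) =
      cubeGLin (X ^ antipodalPairs S * (X + C (X - 1)) ^ antipodallyUnpaired S *
        (X + C (2 * (X - 1))) ^ (n - antipodallyUnpaired S - antipodalPairs S)) := by
  have h1 : ∑ a with a ≤ b ∧ a ≠ ⊥ ∧ ¬ Q a, toricG a * (X - 1) ^ (n + 1 - posetRank a) =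
      ∑ a with a ≤ b ∧ a ≠ ⊥ ∧ ¬ Q a,
        cubeG (posetRank a - 1) * (X - 1) ^ (n + 1 - posetRank a) := by
    refine Finset.sum_congr rfl fun a ha => ?_
    rw [toricG_eq_cubeG hP a (Finset.mem_filter.1 ha).2.2.1]
  have h2 := prod_facets S (X : ℤ[X][X]) (C (X - 1))
  rw [h1, map_mul C, map_ofNat, ← h2, ← sum_cubeG_dim, sum_faces e (fun a => ¬ Q a)
    (fun a => cubeG (posetRank a - 1) * (X - 1) ^ (n + 1 - posetRank a))]
  refine Finset.sum_congr (Finset.filter_congr fun c _ => not_congr ?_) fun c _ => ?_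
  · rw [hS _ (by simp)]
    simp only [OrderIso.apply_symm_apply, WithBot.coe_le_coe]
  · rw [posetRank_symm, Nat.add_sub_cancel, Nat.add_sub_add_right]

theorem shellingContribution_eq {P : Type*} [Fintype P] [SemilatticeInf P] [OrderBot P]
    (hP : IsCubicalComplex P) {d r : ℕ} {F : Fin r → P} {τ : Fin r → ℕ × ℕ}
    (hF : IsCubicalShelling d F τ) (t : Fin r) {i j : ℕ} (hτ : τ t = (i, j)) (hj : j + 1 < d) :
    i + j + 1 ≤ d ∧ (i = 0 → j = 0) ∧ shellingContribution F t = fPoly d i j := by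
  classical
  obtain ⟨n, rfl⟩ : ∃ n, d = n + 1 := ⟨d - 1, by omega⟩
  have hheight : ∀ u, Order.height (F u) = (n + 1 : ℕ) := by
    intro u
    obtain ⟨e, -⟩ := hF.type u
    exact height_of_orderIso e
  obtain ⟨e, S, hS, hi, hj'⟩ : ∃ (e : Set.Iic (F t) ≃o WithBot (CubeFace n))
      (S : Finset (Fin n × Bool)), (∀ a : Set.Iic (F t), e a ≠ ⊥ →
        ((∃ u < t, a.1 ≤ F u) ↔ ∃ p ∈ S, e a ≤ (cubeFacet p : CubeFace n))) ∧
      antipodallyUnpaired S = (τ t).1 ∧ antipodalPairs S = (τ t).2 := hF.type t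
  rw [hτ] at hi hj'
  simp only at hi hj'
  have hcard := antipodallyUnpaired_add_antipodalPairs_le S
  rw [hi, hj'] at hcard
  have hzero : (t : ℕ) = 0 → i = 0 ∧ j = 0 := by
    intro ht
    have : S = ∅ := by
      refine Finset.eq_empty_of_forall_notMem fun p hp => ?_
      obtain ⟨u, hu, -⟩ := (hS (e.symm ((cubeFacet p : CubeFace n) : WithBot (CubeFace n)))
        (by simp)).2 ⟨p, hp, by simp⟩
      exact absurd (Fin.lt_def.1 hu) (by omega)
    rw [← hi, ← hj', this]
    exact ⟨rfl, by simp [antipodalPairs]⟩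
  -- The alternative j = d - 1 of the shelling condition is excluded, so a later component has an
  -- unpaired facet.
  have hpos : (t : ℕ) ≠ 0 → 1 ≤ i := by
    intro h0
    have := hF.ball_or_sphere t (by omega)
    rw [hτ] at this
    simp only at this
    omega
  refine ⟨by omega, fun h => ?_, ?_⟩
  · by_contra h0
    by_cases ht : (t : ℕ) = 0
    · exact h0 (hzero ht).2
    · have := hpos ht
      omega
  have hnew := sum_new_faces hP e S (fun a => ∃ u < t, a ≤ F u) hS
  rw [hi, hj'] at hnew
  set φ : P → ℤ[X] := fun a => toricG a * (X - 1) ^ (n + 1 - posetRank a)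
  have h1 : shellingContribution F t =
      ∑ a with a ≤ F t ∧ ¬ ∃ u < t, a ≤ F u, φ a := by
    rw [shellingContribution, toricF_eq_sum (p := fun u => u ≤ t) hheight,
      toricF_eq_sum (p := fun u => u < t) hheight, sub_eq_iff_eq_add',
      ← Finset.sum_filter_add_sum_filter_not _ (fun a => ∃ u < t, a ≤ F u)]
    congr 1
    · refine Finset.sum_congr ?_ fun _ _ => rfl
      ext a
      simp only [Finset.mem_filter, Finset.mem_univ, true_and]
      exact ⟨fun h => h.2, fun ⟨u, hu, ha⟩ => ⟨⟨u, hu.le, ha⟩, u, hu, ha⟩⟩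
    · refine Finset.sum_congr ?_ fun _ _ => rfl
      ext a
      simp only [Finset.mem_filter, Finset.mem_univ, true_and]
      refine ⟨fun ⟨⟨u, hu, ha⟩, h⟩ => ⟨?_, h⟩, fun ⟨ha, h⟩ => ⟨⟨t, le_rfl, ha⟩, h⟩⟩
      rcases hu.lt_or_eq with hu | rfl
      · exact absurd ⟨u, hu, ha⟩ h
      · exact ha
  rw [h1, fPoly_eq_coeff_shellSeries (by omega)]
  -- For the first component the empty face is new and supplies the term (x - 1)^(n+1); for later
  -- ones it already lies in the first facet.
  by_cases ht : (t : ℕ) = 0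
  · obtain ⟨rfl, rfl⟩ := hzero ht
    have hlt : ∀ u, ¬ u < t := fun u hu => absurd (Fin.lt_def.1 hu) (by omega)
    have h2 := cubeGLin_X_add_pow n
    rw [pow_zero, pow_zero, one_mul, one_mul, Nat.sub_zero, Nat.sub_zero] at hnew
    rw [← h2, ← hnew, add_comm, ← Finset.add_sum_erase _ _
      (show (⊥ : P) ∈ Finset.univ.filter (fun a => a ≤ F t ∧ ¬ ∃ u < t, a ≤ F u) by simp [hlt])]
    congr 1
    · change toricG ⊥ * _ = _
      rw [toricG_eq, if_pos rfl, posetRank_bot, one_mul, Nat.sub_zero]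
    · refine Finset.sum_congr ?_ fun _ _ => rfl
      ext a
      simp only [Finset.mem_erase, Finset.mem_filter, Finset.mem_univ, true_and]
      tauto
  · have h2 := cubeGLin_prod (hpos ht) j (n - i - j)
    rw [show i + j + (n - i - j) = n by omega, ← hnew] at h2
    rw [← h2]
    refine Finset.sum_congr ?_ fun _ _ => rfl
    ext a
    simp only [Finset.mem_filter, Finset.mem_univ, true_and]
    refine ⟨fun ⟨ha, h⟩ => ⟨ha, ?_, h⟩, fun ⟨ha, _, h⟩ => ⟨ha, h⟩⟩
    rintro rfl
    exact h ⟨⟨0, by have := t.2; omega⟩, Fin.lt_def.2 (by simp; omega), bot_le⟩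

/-! ### Weighted Motzkin paths -/

/-- The transfer operator of Motzkin paths with up, level and down steps of weights `1`, `2x`
and `x`. -/
noncomputable def motzkinStep : Module.End ℤ[X] (ℕ → ℤ[X]) where
  toFun φ h := φ (h + 1) + 2 * X * φ h + if h = 0 then 0 else X * φ (h - 1)
  map_add' φ ψ := by
    funext h
    simp only [Pi.add_apply]
    split_ifs <;> ring
  map_smul' a φ := by
    funext h
    simp only [Pi.smul_apply, smul_eq_mul, RingHom.id_apply]
    split_ifs <;> ring

theorem motzkinStep_apply (φ : ℕ → ℤ[X]) (h : ℕ) :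
    motzkinStep φ h = φ (h + 1) + 2 * X * φ h + if h = 0 then 0 else X * φ (h - 1) := rfl

/-- The indicator of height `0`. -/
noncomputable def heightZero : ℕ → ℤ[X] := fun h => if h = 0 then 1 else 0

/-- Multiplying K = T(K² + 2xK + x) by K^h gives the step recursion of the paths. For h = 0 the down
term is the constant x, which matters only for the coefficient of T; this is the missing step below
height 0. -/
theorem X_mul_motzkinStep_pow (l h : ℕ) :
    X * (motzkinStep ^ l) heightZero h =
      PowerSeries.coeff (l + 1) ((shellSeries 1 0 - PowerSeries.C X) ^ (h + 1)) := by
  have hK := shellSeries_one_zero_sub_quadratic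
  set K := shellSeries 1 0 - PowerSeries.C X
  have hrec : ∀ l h, PowerSeries.coeff (l + 1) (K ^ (h + 1)) = PowerSeries.coeff l (K ^ (h + 2)) +
      2 * X * PowerSeries.coeff l (K ^ (h + 1)) + X * PowerSeries.coeff l (K ^ h) := by
    intro l h
    have : K ^ (h + 1) = PowerSeries.X * (K ^ (h + 2) + PowerSeries.C (2 * X) * K ^ (h + 1) +
        PowerSeries.C X * K ^ h) := by
      linear_combination K ^ h * hK
    rw [this, PowerSeries.coeff_succ_X_mul, map_add, map_add, PowerSeries.coeff_C_mul,
      PowerSeries.coeff_C_mul, ← this]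
  have hK0 : PowerSeries.constantCoeff K = 0 := by
    rw [hK]
    simp
  induction l generalizing h with
  | zero =>
    rw [hrec, pow_zero]
    cases h <;> simp [heightZero, hK0]
  | succ l ih =>
    rw [pow_succ', Module.End.mul_apply, motzkinStep_apply, hrec, ← ih, ← ih]
    cases h with
    | zero =>
      rw [if_pos rfl, pow_zero, PowerSeries.coeff_one, if_neg (by omega)]
      ring
    | succ h =>
      rw [if_neg (by omega), Nat.add_sub_cancel, ← ih]
      ring

/-! ### Words of noncrossing partitions as Motzkin paths -/

/-- The weights of the words whose letters are the positions of a noncrossing partition of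
`{1, …, n}`, counted by the completions of a word with `h` open blocks; the flag tells whether the
block of `1` is open, and the number `r` of remaining letters is the argument of the recursion. -/
noncomputable def completionWeight (n i j : ℕ) : ℕ → ℕ → Bool → ℤ[X]
  | 0, h, _ => if h = 0 then 1 else 0
  | r + 1, h, op =>
    completionWeight n i j r (h + 1) op +
    (if n - r ≤ i ∨ n + 1 ≤ n - r + j then 1 else X) * completionWeight n i j r h op +
    if h = 0 then 0 else
      (if n + 1 ≤ n - r + j then 1 else X) * completionWeight n i j r h op +
      if h = 1 ∧ op = true then
        (if n + 1 ≤ n - r + j then 1 else X) * completionWeight n i j r 0 false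
      else X * completionWeight n i j r (h - 1) op

/-- The completions with the block of `1` closed, together with those that have it open besides
`h` other open blocks, are Motzkin paths. -/
theorem completionWeight_add_succ (n i j r h : ℕ) :
    completionWeight n i j (r + 1) h false + completionWeight n i j (r + 1) (h + 1) true =
      motzkinStep (fun h => completionWeight n i j r h false +
        completionWeight n i j r (h + 1) true) h +
      ((if n - r ≤ i ∨ n + 1 ≤ n - r + j then 1 else X) +
        (if n + 1 ≤ n - r + j then 1 else X) - 2 * X) *
        (completionWeight n i j r h false + completionWeight n i j r (h + 1) true) := by
  rw [motzkinStep_apply, completionWeight, completionWeight]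
  generalize (if n - r ≤ i ∨ n + 1 ≤ n - r + j then 1 else X : ℤ[X]) = a
  generalize (if n + 1 ≤ n - r + j then 1 else X : ℤ[X]) = b
  -- At h = 0 the state with no open block has only the level weight a. Closing the block of 1 leads
  -- from the other merged state to this one with weight b, so the total level weight is a + b here
  -- too.
  cases h with
  | zero =>
    simp
    ring
  | succ h =>
    simp
    ring

/-- The level weight a + b is 1 + x, 2x or 2 in the three zones of positions (first i, middle l,
last j), that is, 2x minus w, 0 or 2w. Each letter read backwards thus applies the step operator
shifted by that scalar. -/
theorem completionWeight_add_eq {i l j : ℕ} (s : ℕ) (hs : s ≤ i) (h : ℕ) :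
    completionWeight (i + l + j) i j (s + l + j) h false +
      completionWeight (i + l + j) i j (s + l + j) (h + 1) true =
      aeval motzkinStep ((X - C (X - 1)) ^ s * X ^ l * (X - C (2 * (X - 1))) ^ j : ℤ[X][X])
        heightZero h := by
  have hstep : ∀ (r : ℕ) (p : ℤ[X][X]) (a : ℤ[X]),
      (∀ h, completionWeight (i + l + j) i j r h false +
        completionWeight (i + l + j) i j r (h + 1) true = aeval motzkinStep p heightZero h) →
      (if i + l + j - r ≤ i ∨ i + l + j + 1 ≤ i + l + j - r + j then 1 else X) +
        (if i + l + j + 1 ≤ i + l + j - r + j then 1 else X) - 2 * X = - a →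
      ∀ h, completionWeight (i + l + j) i j (r + 1) h false +
        completionWeight (i + l + j) i j (r + 1) (h + 1) true =
          aeval motzkinStep ((X - C a) * p) heightZero h := by
    intro r p a hp ha h
    rw [completionWeight_add_succ, ha]
    simp_rw [hp]
    rw [sub_mul, map_sub, map_mul, map_mul, aeval_X, aeval_C, LinearMap.sub_apply,
      Module.End.mul_apply, Module.End.mul_apply, Module.algebraMap_end_apply, Pi.sub_apply,
      Pi.smul_apply, smul_eq_mul]
    ring
  have h3 : ∀ s ≤ j, ∀ h, completionWeight (i + l + j) i j s h false +
      completionWeight (i + l + j) i j s (h + 1) true =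
      aeval motzkinStep ((X - C (2 * (X - 1))) ^ s : ℤ[X][X]) heightZero h := by
    intro s hs
    induction s with
    | zero =>
      intro h
      simp [completionWeight, heightZero]
    | succ s ih =>
      rw [pow_succ']
      refine hstep s _ _ (ih (by omega)) ?_
      rw [if_pos (by omega), if_pos (by omega)]
      ring
  have h2 : ∀ s ≤ l, ∀ h, completionWeight (i + l + j) i j (s + j) h false +
      completionWeight (i + l + j) i j (s + j) (h + 1) true =
      aeval motzkinStep (X ^ s * (X - C (2 * (X - 1))) ^ j : ℤ[X][X]) heightZero h := by
    intro s hs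
    induction s with
    | zero => simpa using h3 j le_rfl
    | succ s ih =>
      have := hstep (s + j) _ 0 (ih (by omega)) (by
        rw [if_neg (by omega), if_neg (by omega)]
        ring)
      rw [C_0, sub_zero, ← mul_assoc, ← pow_succ'] at this
      rw [show s + 1 + j = s + j + 1 by ring]
      exact this
  induction s generalizing h with
  | zero => simpa using h2 l le_rfl h
  | succ s ih =>
    have := hstep (s + l + j) _ (X - 1) (ih (by omega)) (by
      rw [if_pos (by omega), if_neg (by omega)]
      ring) h
    rw [show s + 1 + l + j = s + l + j + 1 by ring, this, pow_succ']
    simp only [mul_assoc]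

/-- The shifts of the operator by w and 2w are the recursions of the series in i and j. The exponent
is i - 1 because the element 1 precedes the path. -/
theorem X_mul_aeval_motzkinStep {i : ℕ} (hi : 1 ≤ i) (j l : ℕ) :
    X * aeval motzkinStep ((X - C (X - 1)) ^ (i - 1) * X ^ l * (X - C (2 * (X - 1))) ^ j : ℤ[X][X])
        heightZero 0 = PowerSeries.coeff (i + j + l) (shellSeries i j) := by
  have hsub : ∀ (a : ℤ[X]) (p q : ℤ[X][X]),
      X * aeval motzkinStep p heightZero 0 - a * (X * aeval motzkinStep q heightZero 0) =
        X * aeval motzkinStep (p - C a * q) heightZero 0 := by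
    intro a p q
    rw [map_sub, map_mul, aeval_C, LinearMap.sub_apply, Module.End.mul_apply,
      Module.algebraMap_end_apply, Pi.sub_apply, Pi.smul_apply, smul_eq_mul]
    ring
  refine eq_coeff_shellSeries (Φ := fun i j l => X * aeval motzkinStep
    ((X - C (X - 1)) ^ (i - 1) * X ^ l * (X - C (2 * (X - 1))) ^ j : ℤ[X][X]) heightZero 0)
    ?_ ?_ ?_ hi j l
  · intro l
    have h := X_mul_motzkinStep_pow l 0
    rw [zero_add, pow_one, map_sub, PowerSeries.coeff_C, if_neg (by omega), sub_zero] at h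
    simpa using h
  · intro i l hi
    obtain ⟨k, rfl⟩ := Nat.exists_eq_add_of_le' hi
    rw [hsub]
    simp only [Nat.add_sub_cancel]
    refine congrArg (fun p => X * aeval motzkinStep p heightZero 0) ?_
    ring
  · intro i j l _
    rw [hsub]
    refine congrArg (fun p => X * aeval motzkinStep p heightZero 0) ?_
    ring

/-- Without special positions, closing the block of 1 weighs x like any other closing, so the flag
is irrelevant. The series is K^h W(0,0): h descents, then a path from height 0, where the level step
weighs only x; this is W = x + T(KW + xW). -/
theorem X_mul_completionWeight_zero_zero (n r : ℕ) (hr : r ≤ n) (h : ℕ) (op : Bool) :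
    X * completionWeight n 0 0 r h op =
      PowerSeries.coeff r ((shellSeries 1 0 - PowerSeries.C X) ^ h * shellSeries 0 0) := by
  have hK := shellSeries_one_zero_sub_quadratic
  have hW : shellSeries 0 0 = PowerSeries.C X + PowerSeries.X *
      ((shellSeries 1 0 - PowerSeries.C X) * shellSeries 0 0 +
        PowerSeries.C X * shellSeries 0 0) := by
    have hc := catalanComp_eq (u := (PowerSeries.C X * PowerSeries.X *
      (1 - PowerSeries.C (X - 1) * PowerSeries.X) : PowerSeries ℤ[X])) (by simp)
    rw [shellSeries, shellSeries]
    linear_combination PowerSeries.C X * hc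
  set K := shellSeries 1 0 - PowerSeries.C X
  set W := shellSeries 0 0
  have hK0 : PowerSeries.constantCoeff K = 0 := by
    rw [hK]
    simp
  have hW0 : PowerSeries.constantCoeff W = X := by
    rw [hW]
    simp
  induction r generalizing h op with
  | zero => cases h <;> simp [completionWeight, hK0, hW0]
  | succ r ih =>
    have ih' := ih (by omega)
    rw [completionWeight]
    rw [if_neg (show ¬ (n - r ≤ 0 ∨ n + 1 ≤ n - r + 0) by omega),
      if_neg (show ¬ n + 1 ≤ n - r + 0 by omega)]
    cases h with
    | zero =>
      rw [if_pos rfl, pow_zero, one_mul, hW, map_add, PowerSeries.coeff_C, if_neg (by omega),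
        PowerSeries.coeff_succ_X_mul, map_add, PowerSeries.coeff_C_mul]
      have h0 := ih' 0 op
      have h1 := ih' 1 op
      rw [pow_zero, one_mul] at h0
      rw [pow_one] at h1
      linear_combination X * h0 + h1
    | succ h =>
      have hrec : K ^ (h + 1) * W = PowerSeries.X * (K ^ (h + 2) * W +
          PowerSeries.C (2 * X) * (K ^ (h + 1) * W) + PowerSeries.C X * (K ^ h * W)) := by
        linear_combination K ^ h * W * hK
      have h5 : (if h + 1 = 1 ∧ op = true then X * completionWeight n 0 0 r 0 false
          else X * completionWeight n 0 0 r (h + 1 - 1) op) =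
            PowerSeries.coeff r (K ^ h * W) := by
        split_ifs with h0
        · rw [ih', show h = 0 by omega]
        · rw [ih', Nat.add_sub_cancel]
      rw [if_neg (by omega), h5, hrec, PowerSeries.coeff_succ_X_mul, map_add, map_add,
        PowerSeries.coeff_C_mul, PowerSeries.coeff_C_mul]
      linear_combination ih' (h + 2) op + 2 * X * ih' (h + 1) op

/-! ### Noncrossing partitions with open blocks -/

/-- `f` maps each element to the minimum of its block, for a noncrossing partition of
`H ∪ {v, …, n}`, where the elements of `H` lie below `v`, and are the minima of pairwise distinct
blocks that meet `{v, …, n}`. Off this set `f` is the identity. -/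
structure IsBlockMap (n v : ℕ) (H : Finset ℕ) (f : ℕ → ℕ) : Prop where
  le : ∀ w, f w ≤ w
  fix : ∀ w, w < v ∨ n < w → f w = w
  mono : ∀ u w, f w ≤ u → u ≤ w → f w ≤ f u
  mem : ∀ w, v ≤ w → w ≤ n → f w ∈ H ∨ v ≤ f w
  hit : ∀ h ∈ H, ∃ w, v ≤ w ∧ w ≤ n ∧ f w = h

theorem finite_isBlockMap (n v : ℕ) (H : Finset ℕ) : {f | IsBlockMap n v H f}.Finite := by
  have hfin : (Set.univ.pi fun w : Fin (n + 1) => Set.Iic (w : ℕ)).Finite :=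
    Set.Finite.pi fun _ => Set.finite_Iic _
  refine Set.Finite.of_finite_image (f := fun f (w : Fin (n + 1)) => f w) (hfin.subset ?_) ?_
  · rintro _ ⟨f, hf, rfl⟩ w _
    exact hf.le w
  · intro f hf g hg h
    funext w
    by_cases hw : w ≤ n
    · exact congrFun h ⟨w, Nat.lt_succ_of_le hw⟩
    · rw [hf.fix w (by omega), hg.fix w (by omega)]

/-- The condition on `w` to be special, in terms of the minima of the blocks. -/
def IsSpecialFor (n i j : ℕ) (f : ℕ → ℕ) (w : ℕ) : Prop :=
  (f w = w ∧ ∃ p, w < p ∧ f p = w) ∨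
  (f w = w ∧ (∀ p, w < p → f p ≠ w) ∧ (w ≤ i ∨ n + 1 ≤ w + j)) ∨
  (n + 1 ≤ w + j ∧ f w < w ∧ ((∀ p, w < p → f p ≠ f w) → f w = 1))

open Classical in
/-- The weight of an element: special elements have weight `1`, the others weight `x`. -/
noncomputable def blockWeight (n i j : ℕ) (f : ℕ → ℕ) (w : ℕ) : ℤ[X] :=
  if IsSpecialFor n i j f w then 1 else X

/-- Specialness of w depends only on f from w onwards, so altering f at v leaves the weights of all
later elements unchanged. -/
theorem blockWeight_congr {n i j w : ℕ} {f g : ℕ → ℕ} (h : ∀ p, w ≤ p → f p = g p) :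
    blockWeight n i j f w = blockWeight n i j g w := by
  have hw := h w le_rfl
  have h1 : ∀ k, (∃ p, w < p ∧ f p = k) ↔ ∃ p, w < p ∧ g p = k := fun k =>
    exists_congr fun p => and_congr_right fun hp => by rw [h p hp.le]
  have h2 : ∀ k, (∀ p, w < p → f p ≠ k) ↔ ∀ p, w < p → g p ≠ k := fun k =>
    forall_congr' fun p => imp_congr_right fun hp => by rw [h p hp.le]
  have : IsSpecialFor n i j f w ↔ IsSpecialFor n i j g w := by
    rw [IsSpecialFor, IsSpecialFor, hw, h1, h2, h2]
  classical
  rw [blockWeight, blockWeight]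
  exact if_congr this rfl rfl

/-! ### Recursion on the smallest remaining element -/

/-- The weighted count of the noncrossing partitions of `H ∪ {v, …, n}` in which the elements of
`H` are the minima of pairwise distinct nonsingleton blocks. -/
noncomputable def blockSum (n i j v : ℕ) (H : Finset ℕ) : ℤ[X] :=
  ∑ᶠ f ∈ {f | IsBlockMap n v H f}, ∏ w ∈ Finset.Icc v n, blockWeight n i j f w

theorem IsBlockMap.ne_of_lt {n v : ℕ} {H : Finset ℕ} {f : ℕ → ℕ} (hH : ∀ h ∈ H, h < v)
    (hf : IsBlockMap n (v + 1) H f) (p : ℕ) (hp : v < p) : f p ≠ v := by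
  intro h
  by_cases hpn : p ≤ n
  · rcases hf.mem p hp hpn with h' | h'
    · have := hH _ h'
      omega
    · omega
  · have := hf.fix p (by omega)
    omega

theorem isBlockMap_and_singleton_iff {n v : ℕ} {H : Finset ℕ} (hH : ∀ h ∈ H, h < v)
    {f : ℕ → ℕ} : (IsBlockMap n v H f ∧ f v = v ∧ ∀ p, v < p → f p ≠ v) ↔
      IsBlockMap n (v + 1) H f := by
  constructor
  · rintro ⟨hf, hv, hp⟩
    refine ⟨hf.le, fun w hw => ?_, hf.mono, fun w hw hwn => ?_, fun h hh => ?_⟩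
    · by_cases hwv : w = v
      · rw [hwv, hv]
      · exact hf.fix w (by omega)
    · rcases hf.mem w (by omega) hwn with h | h
      · exact Or.inl h
      · have := hp w (by omega)
        right
        omega
    · obtain ⟨w, hw, hwn, rfl⟩ := hf.hit h hh
      refine ⟨w, ?_, hwn, rfl⟩
      have := hH _ hh
      by_contra hlt
      rw [show w = v by omega, hv] at this
      omega
  · intro hf
    have hv : f v = v := hf.fix v (by omega)
    refine ⟨⟨hf.le, fun w hw => hf.fix w (by omega), hf.mono, fun w hw hwn => ?_, fun h hh => ?_⟩,
      hv, hf.ne_of_lt hH⟩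
    · rcases hw.eq_or_lt with rfl | hw
      · exact Or.inr hv.ge
      · exact (hf.mem w hw hwn).imp_right fun h => by omega
    · obtain ⟨w, hw, hwn, rfl⟩ := hf.hit h hh
      exact ⟨w, by omega, hwn, rfl⟩

/-- The map itself does not change, as it fixes v on both sides; v merely becomes an open minimum
that some later element must hit. -/
theorem isBlockMap_and_opener_iff {n v : ℕ} {H : Finset ℕ} (hH : ∀ h ∈ H, h < v)
    {f : ℕ → ℕ} : (IsBlockMap n v H f ∧ f v = v ∧ ∃ p, v < p ∧ f p = v) ↔
      IsBlockMap n (v + 1) (insert v H) f := by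
  constructor
  · rintro ⟨hf, hv, p, hp, hpv⟩
    refine ⟨hf.le, fun w hw => ?_, hf.mono, fun w hw hwn => ?_, fun h hh => ?_⟩
    · by_cases hwv : w = v
      · rw [hwv, hv]
      · exact hf.fix w (by omega)
    · rw [Finset.mem_insert]
      rcases hf.mem w (by omega) hwn with h | h
      · exact Or.inl (Or.inr h)
      · omega
    · rcases Finset.mem_insert.1 hh with rfl | hh
      · refine ⟨p, hp, ?_, hpv⟩
        by_contra hpn
        have := hf.fix p (by omega)
        omega
      · obtain ⟨w, hw, hwn, rfl⟩ := hf.hit h hh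
        refine ⟨w, ?_, hwn, rfl⟩
        have := hH _ hh
        by_contra hlt
        rw [show w = v by omega, hv] at this
        omega
  · intro hf
    have hv : f v = v := hf.fix v (by omega)
    obtain ⟨p, hp, hpn, hpv⟩ := hf.hit v (Finset.mem_insert_self _ _)
    refine ⟨⟨hf.le, fun w hw => hf.fix w (by omega), hf.mono, fun w hw hwn => ?_, fun h hh => ?_⟩,
      hv, p, hp, hpv⟩
    · rcases hw.eq_or_lt with rfl | hw
      · exact Or.inr hv.ge
      · rcases hf.mem w hw hwn with h | h
        · rcases Finset.mem_insert.1 h with h | h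
          · exact Or.inr h.ge
          · exact Or.inl h
        · right
          omega
    · obtain ⟨w, hw, hwn, rfl⟩ := hf.hit h (Finset.mem_insert_of_mem hh)
      exact ⟨w, by omega, hwn, rfl⟩

/-- Some w ≥ v lies in the block of the largest open minimum u, and noncrossing forces u = f w ≤ f
v. A nonminimal element therefore has no choice of block. -/
theorem IsBlockMap.eq_max {n v u : ℕ} {H : Finset ℕ} (hH : ∀ h ∈ H, h < v) (hu : u ∈ H)
    (hmax : ∀ h ∈ H, h ≤ u) {f : ℕ → ℕ} (hf : IsBlockMap n v H f) (hvn : v ≤ n) (hv : f v < v) :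
    f v = u := by
  have hmem : f v ∈ H := (hf.mem v le_rfl hvn).resolve_right (by omega)
  refine le_antisymm (hmax _ hmem) ?_
  obtain ⟨w, hw, -, hwu⟩ := hf.hit u hu
  have := hH u hu
  have h := hf.mono v w (by omega) hw
  omega

/-- Removing `v` from the innermost open block. -/
theorem IsBlockMap.update_self {n v : ℕ} {H H' : Finset ℕ} {f : ℕ → ℕ} (hf : IsBlockMap n v H f)
    (hH' : ∀ h ∈ H', h ∈ H) (hmem : ∀ w, v < w → f w ∈ H → f w ∈ H')
    (hne : ∀ w, v < w → f w ≠ v) (hhit : f v ∈ H' → ∃ p, v < p ∧ p ≤ n ∧ f p = f v) :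
    IsBlockMap n (v + 1) H' (Function.update f v v) := by
  have hup : ∀ w, w ≠ v → Function.update f v v w = f w := fun w hw => Function.update_of_ne hw _ _
  have hself : Function.update f v v v = v := Function.update_self _ _ _
  refine ⟨fun w => ?_, fun w hw => ?_, fun u w h1 h2 => ?_, fun w hw hwn => ?_, fun h hh => ?_⟩
  · by_cases hw : w = v
    · rw [hw, hself]
    · rw [hup w hw]
      exact hf.le w
  · by_cases hwv : w = v
    · rw [hwv, hself]
    · rw [hup w hwv]
      exact hf.fix w (by omega)
  · by_cases hw : w = v
    · subst hw
      rw [hself] at h1 ⊢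
      rw [show u = w by omega, hself]
    · rw [hup w hw] at h1 ⊢
      by_cases huv : u = v
      · subst huv
        rwa [hself]
      · rw [hup u huv]
        exact hf.mono u w h1 h2
  · rw [hup w (by omega)]
    rcases hf.mem w (by omega) hwn with h | h
    · exact Or.inl (hmem w (by omega) h)
    · have := hne w (by omega)
      right
      omega
  · obtain ⟨w, hw, hwn, hwh⟩ := hf.hit h (hH' h hh)
    by_cases hwv : w = v
    · subst hwv
      subst hwh
      obtain ⟨p, hp, hpn, hpw⟩ := hhit hh
      exact ⟨p, hp, hpn, by rw [hup p (by omega), hpw]⟩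
    · exact ⟨w, by omega, hwn, by rw [hup w hwv, hwh]⟩

/-- Adding `v` to the innermost open block. -/
theorem IsBlockMap.update_max {n v u : ℕ} {H H' : Finset ℕ} (hH : ∀ h ∈ H, h < v) (hu : u ∈ H)
    (hmax : ∀ h ∈ H, h ≤ u) {f : ℕ → ℕ} (hvn : v ≤ n) (hf : IsBlockMap n (v + 1) H' f)
    (hH' : ∀ h ∈ H', h ∈ H) (hHu : ∀ h ∈ H, h ∈ H' ∨ h = u) :
    IsBlockMap n v H (Function.update f v u) := by
  have hup : ∀ w, w ≠ v → Function.update f v u w = f w := fun w hw => Function.update_of_ne hw _ _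
  have hself : Function.update f v u v = u := Function.update_self _ _ _
  have huv := hH u hu
  refine ⟨fun w => ?_, fun w hw => ?_, fun p w h1 h2 => ?_, fun w hw hwn => ?_, fun h hh => ?_⟩
  · by_cases hw : w = v
    · rw [hw, hself]
      omega
    · rw [hup w hw]
      exact hf.le w
  · rw [hup w (by omega)]
    exact hf.fix w (by omega)
  · by_cases hw : w = v
    · subst hw
      rw [hself] at h1 ⊢
      by_cases hpw : p = w
      · rw [hpw, hself]
      · rw [hup p hpw, hf.fix p (by omega)]
        exact h1
    · rw [hup w hw] at h1 ⊢
      by_cases hpv : p = v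
      · subst hpv
        rw [hself]
        by_cases hwn : w ≤ n
        · rcases hf.mem w (by omega) hwn with h | h
          · exact hmax _ (hH' _ h)
          · omega
        · have := hf.fix w (by omega)
          omega
      · rw [hup p hpv]
        exact hf.mono p w h1 h2
  · by_cases hwv : w = v
    · rw [hwv, hself]
      exact Or.inl hu
    · rw [hup w hwv]
      rcases hf.mem w (by omega) hwn with h | h
      · exact Or.inl (hH' _ h)
      · right
        omega
  · rcases hHu h hh with h' | rfl
    · obtain ⟨w, hw, hwn, hwh⟩ := hf.hit h h'
      exact ⟨w, by omega, hwn, by rw [hup w (by omega), hwh]⟩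
    · exact ⟨v, le_rfl, hvn, hself⟩

/-- The value at v is forced to be u, so resetting it to v loses nothing. As v is not the last of
its block, u remains open. -/
theorem bijOn_update_middle {n v u : ℕ} {H : Finset ℕ} (hH : ∀ h ∈ H, h < v) (hu : u ∈ H)
    (hmax : ∀ h ∈ H, h ≤ u) (hvn : v ≤ n) :
    Set.BijOn (fun f : ℕ → ℕ => Function.update f v v)
      {f | IsBlockMap n v H f ∧ f v < v ∧ ∃ p, v < p ∧ f p = f v}
      {f | IsBlockMap n (v + 1) H f} := by
  refine ⟨?_, ?_, ?_⟩
  · rintro f ⟨hf, hv, p, hp, hpv⟩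
    refine hf.update_self (fun h hh => hh) (fun w _ hw => hw) (fun w hw h => ?_) fun _ =>
      ⟨p, hp, ?_, hpv⟩
    · have := hf.mono v w h.le hw.le
      omega
    · by_contra hpn
      have := hf.fix p (by omega)
      omega
  · rintro f ⟨hf, hv, -⟩ g ⟨hg, hgv, -⟩ h
    funext w
    by_cases hw : w = v
    · rw [hw, hf.eq_max hH hu hmax hvn hv, hg.eq_max hH hu hmax hvn hgv]
    · simpa [hw] using congrFun h w
  · intro f hf
    refine ⟨Function.update f v u, ⟨hf.update_max hH hu hmax hvn (fun h hh => hh)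
      (fun h hh => Or.inl hh), ?_, ?_⟩, ?_⟩
    · simpa using hH u hu
    · obtain ⟨p, hp, hpn, hpu⟩ := hf.hit u hu
      refine ⟨p, hp, ?_⟩
      rw [Function.update_self, Function.update_of_ne (by omega), hpu]
    · have := hf.fix v (by omega)
      funext w
      by_cases hw : w = v
      · subst hw
        simp [this]
      · simp [hw]

/-- Here v is the last element of its block, so u is no longer hit afterwards and leaves the set of
open minima. -/
theorem bijOn_update_closer {n v u : ℕ} {H : Finset ℕ} (hH : ∀ h ∈ H, h < v) (hu : u ∈ H)
    (hmax : ∀ h ∈ H, h ≤ u) (hvn : v ≤ n) :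
    Set.BijOn (fun f : ℕ → ℕ => Function.update f v v)
      {f | IsBlockMap n v H f ∧ f v < v ∧ ∀ p, v < p → f p ≠ f v}
      {f | IsBlockMap n (v + 1) (H.erase u) f} := by
  refine ⟨?_, ?_, ?_⟩
  · rintro f ⟨hf, hv, hp⟩
    have hfu := hf.eq_max hH hu hmax hvn hv
    refine hf.update_self (fun h hh => Finset.mem_of_mem_erase hh) (fun w hw hwH => ?_)
      (fun w hw h => ?_) fun h => ?_
    · exact Finset.mem_erase.2 ⟨hfu ▸ hp w hw, hwH⟩
    · have := hf.mono v w h.le hw.le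
      omega
    · rw [hfu] at h
      simp at h
  · rintro f ⟨hf, hv, -⟩ g ⟨hg, hgv, -⟩ h
    funext w
    by_cases hw : w = v
    · rw [hw, hf.eq_max hH hu hmax hvn hv, hg.eq_max hH hu hmax hvn hgv]
    · simpa [hw] using congrFun h w
  · intro f hf
    have huv := hH u hu
    refine ⟨Function.update f v u, ⟨hf.update_max hH hu hmax hvn
      (fun h hh => Finset.mem_of_mem_erase hh) (fun h hh => ?_), ?_, fun p hp => ?_⟩, ?_⟩
    · rw [Finset.mem_erase]
      tauto
    · simpa using hH u hu
    · rw [Function.update_self, Function.update_of_ne (by omega)]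
      intro h
      by_cases hpn : p ≤ n
      · rcases hf.mem p hp hpn with h' | h'
        · exact Finset.ne_of_mem_erase h' h
        · omega
      · have := hf.fix p (by omega)
        omega
    · have := hf.fix v (by omega)
      funext w
      by_cases hw : w = v
      · subst hw
        simp [this]
      · simp [hw]

/-- Weighted sums over block maps whose value at `v` is known to give `v` the weight `a`. -/
theorem finsum_blockWeight {n i j v : ℕ} (hvn : v ≤ n) {A : Set (ℕ → ℕ)} {H : Finset ℕ} {a : ℤ[X]}
    {e : (ℕ → ℕ) → ℕ → ℕ} (hbij : Set.BijOn e A {f | IsBlockMap n (v + 1) H f})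
    (he : ∀ f ∈ A, ∀ p, v < p → e f p = f p) (ha : ∀ f ∈ A, blockWeight n i j f v = a) :
    ∑ᶠ f ∈ A, ∏ w ∈ Finset.Icc v n, blockWeight n i j f w = a * blockSum n i j (v + 1) H := by
  rw [blockSum, mul_finsum_mem' _ _ (finite_isBlockMap _ _ _)]
  refine finsum_mem_eq_of_bijOn e hbij fun f hf => ?_
  have hI : Finset.Icc v n = insert v (Finset.Icc (v + 1) n) := by
    ext w
    simp only [Finset.mem_insert, Finset.mem_Icc]
    omega
  rw [hI, Finset.prod_insert (by simp), ha f hf]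
  congr 1
  refine Finset.prod_congr rfl fun w hw => blockWeight_congr fun p hp => ?_
  have := Finset.mem_Icc.1 hw
  exact (he f hf p (by omega)).symm

theorem blockSum_eq {n i j v : ℕ} (hvn : v ≤ n) {H : Finset ℕ} (hH : ∀ h ∈ H, h < v) :
    blockSum n i j v H = blockSum n i j (v + 1) (insert v H) +
      (if v ≤ i ∨ n + 1 ≤ v + j then 1 else X) * blockSum n i j (v + 1) H +
      ∑ᶠ f ∈ {f | IsBlockMap n v H f ∧ f v < v},
        ∏ w ∈ Finset.Icc v n, blockWeight n i j f w := by
  have hO := finsum_blockWeight (i := i) (j := j) (A := {f | IsBlockMap n v H f ∧ f v = v ∧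
    ∃ p, v < p ∧ f p = v}) (a := 1) (e := id) (H := insert v H) hvn
    (by
      rw [show {f | IsBlockMap n v H f ∧ f v = v ∧ ∃ p, v < p ∧ f p = v} =
        {f | IsBlockMap n (v + 1) (insert v H) f} from
          Set.ext fun f => isBlockMap_and_opener_iff hH]
      exact Set.bijOn_id _)
    (fun _ _ _ _ => rfl) (fun f hf => if_pos (Or.inl hf.2))
  have hS := finsum_blockWeight (i := i) (j := j) (A := {f | IsBlockMap n v H f ∧ f v = v ∧
    ∀ p, v < p → f p ≠ v}) (a := if v ≤ i ∨ n + 1 ≤ v + j then 1 else X) (e := id) (H := H) hvn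
    (by
      rw [show {f | IsBlockMap n v H f ∧ f v = v ∧ ∀ p, v < p → f p ≠ v} =
        {f | IsBlockMap n (v + 1) H f} from
          Set.ext fun f => isBlockMap_and_singleton_iff hH]
      exact Set.bijOn_id _)
    (fun _ _ _ _ => rfl) (fun f hf => by
      classical
      rw [blockWeight]
      refine if_congr ?_ rfl rfl
      obtain ⟨-, h1, h2⟩ := hf
      constructor
      · rintro (⟨-, p, hp, hpv⟩ | ⟨-, -, h⟩ | ⟨-, h, -⟩)
        · exact absurd hpv (h2 p hp)
        · exact h
        · omega
      · exact fun h => Or.inr (Or.inl ⟨h1, h2, h⟩))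
  have hfin := finite_isBlockMap n v H
  have hset : {f | IsBlockMap n v H f} =
      ({f | IsBlockMap n v H f ∧ f v = v ∧ ∃ p, v < p ∧ f p = v} ∪
        {f | IsBlockMap n v H f ∧ f v = v ∧ ∀ p, v < p → f p ≠ v}) ∪
      {f | IsBlockMap n v H f ∧ f v < v} := by
    ext f
    constructor
    · intro hf
      rcases (hf.le v).eq_or_lt with h | h
      · by_cases hp : ∃ p, v < p ∧ f p = v
        · exact Or.inl (Or.inl ⟨hf, h, hp⟩)
        · exact Or.inl (Or.inr ⟨hf, h, fun p h1 h2 => hp ⟨p, h1, h2⟩⟩)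
      · exact Or.inr ⟨hf, h⟩
    · rintro ((⟨hf, -⟩ | ⟨hf, -⟩) | ⟨hf, -⟩) <;> exact hf
  have hsub : ∀ Q : (ℕ → ℕ) → Prop, {f | IsBlockMap n v H f ∧ Q f}.Finite :=
    fun Q => hfin.subset fun f hf => hf.1
  rw [one_mul] at hO
  rw [blockSum, hset, finsum_mem_union ?_ ((hsub _).union (hsub _)) (hsub _),
    finsum_mem_union ?_ (hsub _) (hsub _), hO, hS]
  · rw [Set.disjoint_left]
    rintro f ⟨-, -, p, hp, hpv⟩ ⟨-, -, h⟩
    exact h p hp hpv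
  · rw [Set.disjoint_left]
    rintro f (⟨-, h, -⟩ | ⟨-, h, -⟩) ⟨-, h'⟩ <;> omega

theorem blockSum_empty {n i j v : ℕ} (hvn : v ≤ n) :
    blockSum n i j v ∅ = blockSum n i j (v + 1) {v} +
      (if v ≤ i ∨ n + 1 ≤ v + j then 1 else X) * blockSum n i j (v + 1) ∅ := by
  have h : {f | IsBlockMap n v ∅ f ∧ f v < v} = ∅ := by
    refine Set.eq_empty_of_forall_notMem ?_
    rintro f ⟨hf, hv⟩
    rcases hf.mem v le_rfl hvn with h | h
    · simp at h
    · omega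
  rw [blockSum_eq hvn (by simp), h, finsum_mem_empty, add_zero]
  rfl

theorem blockSum_of_max {n i j v u : ℕ} (hvn : v ≤ n) {H : Finset ℕ} (hH : ∀ h ∈ H, h < v)
    (hu : u ∈ H) (hmax : ∀ h ∈ H, h ≤ u) :
    blockSum n i j v H = blockSum n i j (v + 1) (insert v H) +
      (if v ≤ i ∨ n + 1 ≤ v + j then 1 else X) * blockSum n i j (v + 1) H +
      ((if n + 1 ≤ v + j then 1 else X) * blockSum n i j (v + 1) H +
      (if n + 1 ≤ v + j ∧ u = 1 then 1 else X) * blockSum n i j (v + 1) (H.erase u)) := by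
  classical
  have hM := finsum_blockWeight (i := i) (j := j) (a := if n + 1 ≤ v + j then 1 else X) hvn
    (bijOn_update_middle hH hu hmax hvn) (fun _ _ _ hp => Function.update_of_ne (by omega) _ _)
    (fun f hf => by
      rw [blockWeight]
      refine if_congr ?_ rfl rfl
      obtain ⟨-, h1, p, hp, hpv⟩ := hf
      constructor
      · rintro (⟨h, -⟩ | ⟨h, -⟩ | ⟨h, -⟩)
        · omega
        · omega
        · exact h
      · exact fun h => Or.inr (Or.inr ⟨h, h1, fun h' => absurd hpv (h' p hp)⟩))
  have hC := finsum_blockWeight (i := i) (j := j) (a := if n + 1 ≤ v + j ∧ u = 1 then 1 else X) hvn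
    (bijOn_update_closer hH hu hmax hvn) (fun _ _ _ hp => Function.update_of_ne (by omega) _ _)
    (fun f hf => by
      rw [blockWeight]
      refine if_congr ?_ rfl rfl
      obtain ⟨hf, h1, hp⟩ := hf
      have hfu := hf.eq_max hH hu hmax hvn h1
      constructor
      · rintro (⟨h, -⟩ | ⟨h, -⟩ | ⟨h, -, h'⟩)
        · omega
        · omega
        · exact ⟨h, hfu ▸ h' hp⟩
      · exact fun h => Or.inr (Or.inr ⟨h.1, h1, fun _ => hfu.trans h.2⟩))
  have hset : {f | IsBlockMap n v H f ∧ f v < v} =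
      {f | IsBlockMap n v H f ∧ f v < v ∧ ∃ p, v < p ∧ f p = f v} ∪
        {f | IsBlockMap n v H f ∧ f v < v ∧ ∀ p, v < p → f p ≠ f v} := by
    ext f
    constructor
    · rintro ⟨hf, h⟩
      by_cases hp : ∃ p, v < p ∧ f p = f v
      · exact Or.inl ⟨hf, h, hp⟩
      · exact Or.inr ⟨hf, h, fun p h1 h2 => hp ⟨p, h1, h2⟩⟩
    · rintro (⟨hf, h, -⟩ | ⟨hf, h, -⟩) <;> exact ⟨hf, h⟩
  have hsub : ∀ Q : (ℕ → ℕ) → Prop, {f | IsBlockMap n v H f ∧ Q f}.Finite :=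
    fun Q => (finite_isBlockMap n v H).subset fun f hf => hf.1
  rw [blockSum_eq hvn hH, hset, finsum_mem_union ?_ (hsub _) (hsub _), hM, hC]
  rw [Set.disjoint_left]
  rintro f ⟨-, -, p, hp, hpv⟩ ⟨-, -, h⟩
  exact h p hp hpv

/-- The recursion sees H only through its size and whether it contains 1. The bound 2 ≤ v ensures
that opening a block at v does not change the flag. -/
theorem blockSum_eq_completionWeight {n i j r v : ℕ} (hr : v + r = n + 1) (hv : 2 ≤ v)
    {H : Finset ℕ} (hH : ∀ h ∈ H, 1 ≤ h ∧ h < v) :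
    blockSum n i j v H = completionWeight n i j r H.card (decide (1 ∈ H)) := by
  induction r generalizing v H with
  | zero =>
    have hvn : v = n + 1 := by omega
    subst hvn
    rw [completionWeight, blockSum]
    split_ifs with h
    · rw [Finset.card_eq_zero] at h
      subst h
      have : {f | IsBlockMap n (n + 1) ∅ f} = {id} := by
        ext f
        constructor
        · intro hf
          funext w
          exact hf.fix w (by omega)
        · rintro rfl
          exact ⟨fun _ => le_rfl, fun _ _ => rfl, fun _ _ h _ => h, fun _ _ _ => by
            omega, by simp⟩
      rw [this, finsum_mem_singleton]
      simp
    · have : {f | IsBlockMap n (n + 1) H f} = ∅ := by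
        refine Set.eq_empty_of_forall_notMem fun f hf => h ?_
        rw [Finset.card_eq_zero]
        refine Finset.eq_empty_of_forall_notMem fun h hh => ?_
        obtain ⟨w, hw, hwn, -⟩ := IsBlockMap.hit hf h hh
        omega
      rw [this, finsum_mem_empty]
  | succ r ih =>
    have hvn : v ≤ n := by omega
    have hnr : n - r = v := by omega
    have hlt : ∀ h ∈ H, h < v := fun h hh => (hH h hh).2
    have hnot : v ∉ H := fun h => lt_irrefl _ (hlt v h)
    have hO : blockSum n i j (v + 1) (insert v H) =
        completionWeight n i j r (H.card + 1) (decide (1 ∈ H)) := by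
      rw [ih (by omega) (by omega), Finset.card_insert_of_notMem hnot]
      · congr 1
        rw [decide_eq_decide, Finset.mem_insert]
        exact or_iff_right (by omega)
      · intro h hh
        rcases Finset.mem_insert.1 hh with rfl | hh
        · omega
        · have := hH h hh
          omega
    have hS : blockSum n i j (v + 1) H = completionWeight n i j r H.card (decide (1 ∈ H)) :=
      ih (by omega) (by omega) fun h hh => by
        have := hH h hh
        omega
    rw [completionWeight, hnr]
    rcases H.eq_empty_or_nonempty with rfl | hne
    · rw [blockSum_empty hvn, ← insert_empty_eq, hO, hS, Finset.card_empty, if_pos rfl, add_zero]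
    · have hu := H.max'_mem hne
      have hmax : ∀ h ∈ H, h ≤ H.max' hne := fun h hh => H.le_max' h hh
      set u := H.max' hne
      rw [blockSum_of_max hvn hlt hu hmax, hO, hS, if_neg (Finset.card_ne_zero_of_mem hu)]
      congr 2
      have hE : blockSum n i j (v + 1) (H.erase u) =
          completionWeight n i j r (H.card - 1) (decide (1 ∈ H.erase u)) := by
        rw [ih (by omega) (by omega), Finset.card_erase_of_mem hu]
        intro h hh
        have := hH h (Finset.mem_of_mem_erase hh)
        omega
      rw [hE]
      -- The innermost open block is that of 1 only when no other block is open, since 1 is the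
      -- least possible minimum.
      by_cases hu1 : u = 1
      · have hH1 : H = {1} := by
          ext h
          rw [Finset.mem_singleton]
          refine ⟨fun hh => ?_, ?_⟩
          · have := hmax h hh
            have := hH h hh
            omega
          · rintro rfl
            rwa [hu1] at hu
        rw [hu1, hH1]
        simp
      · rw [if_neg (fun h => hu1 h.2), if_neg]
        · congr 2
          rw [decide_eq_decide, Finset.mem_erase]
          exact and_iff_right (Ne.symm hu1)
        · rintro ⟨hc, h1⟩
          obtain ⟨a, rfl⟩ := Finset.card_eq_one.1 hc
          have h1' : 1 ∈ ({a} : Finset ℕ) := by simpa using h1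
          rw [Finset.mem_singleton] at hu h1'
          exact hu1 (hu.trans h1'.symm)

/-- The weighted count of all noncrossing partitions. -/
theorem X_mul_blockSum {n i j : ℕ} (hn : 1 ≤ n) (hij : i + j ≤ n) (h0 : i = 0 → j = 0) :
    X * blockSum n i j 1 ∅ = PowerSeries.coeff n (shellSeries i j) := by
  rw [blockSum_empty hn, blockSum_eq_completionWeight (r := n - 1) (by omega) le_rfl (by simp),
    blockSum_eq_completionWeight (r := n - 1) (by omega) le_rfl (by simp)]
  simp only [Finset.card_singleton, Finset.mem_singleton, decide_true, Finset.card_empty,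
    Finset.notMem_empty, decide_false]
  -- For i = 0 the element 1 weighs x as a singleton and the series of type (0,0) applies. For i ≥ 1
  -- it weighs 1 both as singleton and as opener, so the two terms add up to the merged state at
  -- height 0.
  rcases Nat.eq_zero_or_pos i with rfl | hi
  · obtain rfl := h0 rfl
    obtain ⟨m, rfl⟩ := Nat.exists_eq_add_of_le' hn
    have h := X_mul_completionWeight_zero_zero (m + 1) (m + 1) le_rfl 0 false
    rw [completionWeight, pow_zero, one_mul] at h
    rw [← h]
    have h1 := X_mul_completionWeight_zero_zero (m + 1) m (by omega) 1 false
    rw [← X_mul_completionWeight_zero_zero (m + 1) m (by omega) 1 true] at h1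
    simp only [Nat.add_sub_cancel, Nat.add_sub_cancel_left]
    simp only [add_zero, zero_add, if_true]
    linear_combination -h1
  · rw [if_pos (Or.inl (Nat.succ_le_of_lt hi)), one_mul, add_comm]
    have h := completionWeight_add_eq (i := i) (l := n - i - j) (j := j) (i - 1) (by omega) 0
    rw [show i + (n - i - j) + j = n by omega, show i - 1 + (n - i - j) + j = n - 1 by omega] at h
    rw [h, X_mul_aeval_motzkinStep hi, show i + j + (n - i - j) = n by omega]

/-! ### Noncrossing partitions and the minima of their blocks -/

/-- The map that sends each element to the minimum of its block. -/
noncomputable def Finpartition.blockMin {s : Finset ℕ} (π : Finpartition s) (w : ℕ) : ℕ :=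
  if h : w ∈ s then (π.part w).min' ((π.part_nonempty).2 h) else w

namespace Finpartition

variable {s : Finset ℕ} (π : Finpartition s)

theorem blockMin_of_notMem {w : ℕ} (h : w ∉ s) : π.blockMin w = w := dif_neg h

theorem isLeast_blockMin {w : ℕ} (h : w ∈ s) : IsLeast (π.part w : Set ℕ) (π.blockMin w) := by
  rw [blockMin, dif_pos h]
  exact Finset.isLeast_min' _ _

theorem blockMin_le (w : ℕ) : π.blockMin w ≤ w := by
  by_cases h : w ∈ s
  · exact (π.isLeast_blockMin h).2 (π.mem_part h)
  · rw [π.blockMin_of_notMem h]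

theorem blockMin_mem {w : ℕ} (h : w ∈ s) : π.blockMin w ∈ s :=
  π.part_subset w (π.isLeast_blockMin h).1

theorem mem_part_iff_blockMin {p w : ℕ} (hp : p ∈ s) (hw : w ∈ s) :
    p ∈ π.part w ↔ π.blockMin p = π.blockMin w := by
  rw [π.mem_part_iff_part_eq_part hp hw]
  constructor
  · intro h
    have h1 := π.isLeast_blockMin hp
    rw [h] at h1
    exact h1.unique (π.isLeast_blockMin hw)
  · intro h
    have h1 := (π.isLeast_blockMin hp).1
    have h2 := (π.isLeast_blockMin hw).1
    rw [h] at h1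
    have hm := π.blockMin_mem hw
    rw [← (π.mem_part_iff_part_eq_part hm hp).1 h1, (π.mem_part_iff_part_eq_part hm hw).1 h2]

theorem isLeast_part_iff {w : ℕ} (hw : w ∈ s) :
    IsLeast (π.part w : Set ℕ) w ↔ π.blockMin w = w :=
  ⟨fun h => (π.isLeast_blockMin hw).unique h, fun h => by
    have := π.isLeast_blockMin hw
    rwa [h] at this⟩

theorem exists_blockMin_eq_iff {w : ℕ} (hw : w ∈ s) :
    (∃ p, w < p ∧ π.blockMin p = π.blockMin w) ↔ ∃ p ∈ π.part w, w < p := by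
  constructor
  · rintro ⟨p, hp, h⟩
    have hps : p ∈ s := by
      by_contra hps
      rw [π.blockMin_of_notMem hps] at h
      have := π.blockMin_le w
      omega
    exact ⟨p, (π.mem_part_iff_blockMin hps hw).2 h, hp⟩
  · rintro ⟨p, hp, h⟩
    exact ⟨p, h, (π.mem_part_iff_blockMin (π.part_subset w hp) hw).1 hp⟩

theorem isGreatest_part_iff {w : ℕ} (hw : w ∈ s) :
    IsGreatest (π.part w : Set ℕ) w ↔ ∀ p, w < p → π.blockMin p ≠ π.blockMin w := by
  have h := π.exists_blockMin_eq_iff hw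
  constructor
  · intro hg p hp hpw
    obtain ⟨q, hq, hlt⟩ := h.1 ⟨p, hp, hpw⟩
    exact absurd (hg.2 hq) (by omega)
  · intro hg
    refine ⟨π.mem_part hw, fun q hq => ?_⟩
    by_contra hlt
    obtain ⟨p, hp, hpw⟩ := h.2 ⟨q, hq, by omega⟩
    exact hg p hp hpw

end Finpartition

theorem isSpecial_iff {n i j w : ℕ} (π : Finpartition (Finset.Icc 1 n)) (hw : w ∈ Finset.Icc 1 n) :
    IsSpecial π (n + 1) i j w ↔ IsSpecialFor n i j π.blockMin w := by
  have hpart : ∀ B ∈ π.parts, w ∈ B → B = π.part w := fun B hB h => (π.part_eq_of_mem hB h).symm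
  have hmem : π.part w ∈ π.parts := π.part_mem.2 hw
  have hself : w ∈ π.part w := π.mem_part hw
  have hone : 1 ∈ π.part w ↔ π.blockMin w = 1 := by
    have hm := Finset.mem_Icc.1 (π.blockMin_mem hw)
    constructor
    · intro h
      have := (π.isLeast_blockMin hw).2 h
      omega
    · intro h
      have := (π.isLeast_blockMin hw).1
      rwa [h] at this
  have hex := π.exists_blockMin_eq_iff hw
  rw [IsSpecial, IsSpecialFor]
  refine or_congr ?_ (or_congr ?_ (and_congr_right fun _ => ?_))
  · constructor
    · rintro ⟨B, hB, hcard, hleast⟩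
      rw [hpart B hB hleast.1] at hcard hleast
      have hmin := (π.isLeast_part_iff hw).1 hleast
      obtain ⟨p, hp, hne⟩ := Finset.exists_mem_ne hcard w
      have hle := hleast.2 hp
      obtain ⟨q, hq⟩ := hex.2 ⟨p, hp, by omega⟩
      rw [hmin] at hq
      exact ⟨hmin, q, hq⟩
    · rintro ⟨hmin, p, hp⟩
      obtain ⟨q, hq, hlt⟩ := hex.1 ⟨p, by rwa [hmin]⟩
      exact ⟨_, hmem, Finset.one_lt_card.2 ⟨w, hself, q, hq, hlt.ne⟩,
        (π.isLeast_part_iff hw).2 hmin⟩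
  · rw [← and_assoc]
    refine and_congr_left fun _ => ?_
    constructor
    · intro h
      have hB := hpart _ h (Finset.mem_singleton_self w)
      have hmin : π.blockMin w = w := by
        rw [← π.isLeast_part_iff hw, ← hB]
        simp
      have := (π.isGreatest_part_iff hw).1 (by
        rw [← hB]
        simp)
      rw [hmin] at this
      exact ⟨hmin, this⟩
    · rintro ⟨hmin, hp⟩
      have hl := (π.isLeast_part_iff hw).2 hmin
      rw [← hmin] at hp
      have hg := (π.isGreatest_part_iff hw).2 (by rwa [hmin] at hp ⊢)
      have : π.part w = {w} := Finset.eq_singleton_iff_unique_mem.2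
        ⟨hself, fun x hx => le_antisymm (hg.2 hx) (hl.2 hx)⟩
      rwa [← this]
  · constructor
    · rintro ⟨B, hB, hwB, hl, hg⟩
      rw [hpart B hB hwB] at hl hg
      rw [π.isLeast_part_iff hw] at hl
      rw [π.isGreatest_part_iff hw, hone] at hg
      exact ⟨lt_of_le_of_ne (π.blockMin_le w) hl, hg⟩
    · rintro ⟨hlt, hg⟩
      refine ⟨_, hmem, hself, ?_, ?_⟩
      · rw [π.isLeast_part_iff hw]
        exact hlt.ne
      · rwa [π.isGreatest_part_iff hw, hone]

theorem bijOn_blockMin (n : ℕ) :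
    Set.BijOn (Finpartition.blockMin (s := Finset.Icc 1 n)) {π | IsNoncrossing π}
      {f | IsBlockMap n 1 ∅ f} := by
  classical
  refine ⟨?_, ?_, ?_⟩
  · intro π hπ
    refine ⟨π.blockMin_le, fun w hw => π.blockMin_of_notMem (by simp; omega), ?_, ?_, by simp⟩
    · intro u w h1 h2
      by_cases hw : w ∈ Finset.Icc 1 n
      · have hm := π.blockMin_mem hw
        have hu : u ∈ Finset.Icc 1 n := by
          rw [Finset.mem_Icc] at hm hw ⊢
          omega
        -- If the inequality fails, the minimum of the block of u, the minimum of the block of w, u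
        -- and w are in increasing order and form a crossing.
        by_contra hlt
        have hmm : π.blockMin (π.blockMin w) = π.blockMin w :=
          (π.mem_part_iff_blockMin hm hw).1 (π.isLeast_blockMin hw).1
        have h3 : π.blockMin w ≠ u := by
          rintro rfl
          omega
        have h4 : u ≠ w := by
          rintro rfl
          omega
        have := hπ (π.blockMin u) (π.blockMin w) u w (by omega) (by omega) (by omega)
          _ (π.part_mem.2 hu) _ (π.part_mem.2 hw) (π.isLeast_blockMin hu).1 (π.mem_part hu)
          (π.isLeast_blockMin hw).1 (π.mem_part hw)
        have := (π.mem_part_iff_blockMin hu hw).1 (this ▸ π.mem_part hu)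
        omega
      · have := π.blockMin_of_notMem hw
        rw [show u = w by omega]
    · intro w h1 h2
      exact Or.inr (Finset.mem_Icc.1 (π.blockMin_mem (Finset.mem_Icc.2 ⟨h1, h2⟩))).1
  · intro π _ π' _ h
    have hpart : ∀ w ∈ Finset.Icc 1 n, π.part w = π'.part w := by
      intro w hw
      ext p
      constructor
      · intro hp
        have hps := π.part_subset w hp
        rw [π'.mem_part_iff_blockMin hps hw, ← h]
        exact (π.mem_part_iff_blockMin hps hw).1 hp
      · intro hp
        have hps := π'.part_subset w hp
        rw [π.mem_part_iff_blockMin hps hw, h]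
        exact (π'.mem_part_iff_blockMin hps hw).1 hp
    have hsub : ∀ ρ ρ' : Finpartition (Finset.Icc 1 n),
        (∀ w ∈ Finset.Icc 1 n, ρ.part w = ρ'.part w) → ρ.parts ⊆ ρ'.parts := by
      intro ρ ρ' hρ B hB
      obtain ⟨w, hw⟩ := ρ.nonempty_of_mem_parts hB
      have hws := ρ.subset hB hw
      rw [← ρ.part_eq_of_mem hB hw, hρ w hws]
      exact ρ'.part_mem.2 hws
    exact Finpartition.ext (Finset.Subset.antisymm (hsub _ _ hpart)
      (hsub _ _ fun w hw => (hpart w hw).symm))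
  · intro f hf
    -- The preimage has the fibres of f as blocks. Monotonicity at u = f w makes f idempotent, so f
    -- w is the minimum of its fibre.
    let π : Finpartition (Finset.Icc 1 n) := Finpartition.ofSetSetoid (Setoid.ker f) _
    have hmem : ∀ p w, p ∈ π.part w ↔ w ∈ Finset.Icc 1 n ∧ p ∈ Finset.Icc 1 n ∧ f w = f p :=
      fun p w => Finpartition.mem_part_ofSetSetoid_iff_rel _
    have hsame : ∀ B ∈ π.parts, ∀ a ∈ B, ∀ b ∈ B, f a = f b := by
      intro B hB a ha b hb
      rw [← π.part_eq_of_mem hB ha, hmem] at hb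
      exact hb.2.2
    refine ⟨π, ?_, ?_⟩
    · intro a b c e hab hbc hce A hA B hB haA hcA hbB heB
      have h1 := hsame A hA a haA c hcA
      have h2 := hsame B hB b hbB e heB
      have ha := hf.le a
      have hb := hf.le b
      -- In a crossing, f e = f b ≤ b ≤ c and f c = f a ≤ a ≤ b. The two monotonicity inequalities
      -- force f b = f c, so the blocks coincide.
      have h3 := hf.mono c e (by omega) (by omega)
      have h4 : f c ≤ f b := hf.mono b c (by omega) (by omega)
      have h5 : b ∈ π.part a := (hmem b a).2 ⟨π.subset hA haA, π.subset hB hbB, by omega⟩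
      rw [π.part_eq_of_mem hA haA] at h5
      rw [← π.part_eq_of_mem hA h5, π.part_eq_of_mem hB hbB]
    · funext w
      by_cases hw : w ∈ Finset.Icc 1 n
      · refine (π.isLeast_blockMin hw).unique ⟨?_, fun p hp => ?_⟩
        · have hw' := Finset.mem_Icc.1 hw
          have h1 := (hf.mem w hw'.1 hw'.2).resolve_left (by simp)
          have h2 := hf.le w
          rw [Finset.mem_coe, hmem]
          refine ⟨hw, Finset.mem_Icc.2 ⟨h1, by omega⟩, le_antisymm (hf.mono _ _ le_rfl h2)
            (hf.le _)⟩
        · rw [Finset.mem_coe, hmem] at hp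
          rw [hp.2.2]
          exact hf.le p
      · rw [π.blockMin_of_notMem hw]
        rw [Finset.mem_Icc] at hw
        exact (hf.fix w (by omega)).symm

theorem prod_blockWeight {n i j : ℕ} (π : Finpartition (Finset.Icc 1 n)) :
    ∏ w ∈ Finset.Icc 1 n, blockWeight n i j π.blockMin w = X ^ (n - specialCount π (n + 1) i j) := by
  classical
  have h := Finset.card_filter_add_card_filter_not (s := Finset.Icc 1 n)
    (fun v => IsSpecial π (n + 1) i j v)
  rw [Nat.card_Icc, Nat.add_sub_cancel] at h
  have hs : specialCount π (n + 1) i j =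
      ((Finset.Icc 1 n).filter fun v => IsSpecial π (n + 1) i j v).card := by
    rw [specialCount]
  rw [hs, show n - _ = ((Finset.Icc 1 n).filter fun v => ¬ IsSpecial π (n + 1) i j v).card by omega,
    ← Finset.prod_const, Finset.prod_filter]
  refine Finset.prod_congr rfl fun w hw => ?_
  rw [blockWeight, ← isSpecial_iff π hw]
  split_ifs <;> rfl

theorem coeff_fPoly_eq_card {n i j m : ℕ} (hij : i + j ≤ n) (h0 : i = 0 → j = 0) (hj : j < n)
    (hm : m ≤ n + 1) :
    (fPoly (n + 1) i j).coeff (n + 1 - m) =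
      (Nat.card {π : Finpartition (Finset.Icc 1 n) //
        IsNoncrossing π ∧ specialCount π (n + 1) i j = m} : ℤ) := by
  classical
  have hsum : blockSum n i j 1 ∅ = ∑ π : Finpartition (Finset.Icc 1 n) with IsNoncrossing π,
      X ^ (n - specialCount π (n + 1) i j) := by
    rw [blockSum, ← finsum_mem_eq_of_bijOn _ (bijOn_blockMin n)
      (f := fun π => X ^ (n - specialCount π (n + 1) i j)) (fun π _ => (prod_blockWeight π).symm),
      ← finsum_mem_coe_finset]
    simp
  -- The bound makes the natural subtraction in the exponent faithful: the extra factor x gives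
  -- exponent n + 1 - count, which is n + 1 - m exactly when the count is m, and for m = n + 1 both
  -- sides are 0.
  have hle : ∀ π : Finpartition (Finset.Icc 1 n), specialCount π (n + 1) i j ≤ n := by
    intro π
    refine (Finset.card_filter_le _ _).trans ?_
    simp
  rw [fPoly_eq_coeff_shellSeries hj.ne, ← X_mul_blockSum (by omega) hij h0, hsum, Finset.mul_sum,
    finsetSum_coeff, Nat.card_eq_fintype_card, Fintype.card_subtype, ← Finset.filter_filter,
    Finset.card_filter, Nat.cast_sum]
  refine Finset.sum_congr rfl fun π _ => ?_
  have := hle π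
  rw [← pow_succ', coeff_X_pow, Nat.cast_ite, Nat.cast_one, Nat.cast_zero]
  exact if_congr (by omega) rfl rfl

theorem mainTheorem4 {P : Type*} [Fintype P] [SemilatticeInf P] [OrderBot P]
    (hP : IsCubicalComplex P) (d r : ℕ) (F : Fin r → P) (τ : Fin r → ℕ × ℕ)
    (hF : IsCubicalShelling d F τ) (t : Fin r) (i j : ℕ) (hτ : τ t = (i, j))
    (hj : j + 1 < d) :
    shellingContribution F t = fPoly d i j ∧
    ∀ m : ℕ, m ≤ d →
      (fPoly d i j).coeff (d - m) =
        (Nat.card {π : Finpartition (Finset.Icc 1 (d - 1)) //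
          IsNoncrossing π ∧ specialCount π d i j = m} : ℤ) := by
  obtain ⟨hij, h0, h⟩ := shellingContribution_eq hP hF t hτ hj
  obtain ⟨n, rfl⟩ : ∃ n, d = n + 1 := ⟨d - 1, by omega⟩
  exact ⟨h, fun m hm => coeff_fPoly_eq_card (by omega) h0 (by omega) hm⟩
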